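/- Let $\mathbb N=\{0,1,2,\dots\}$. For $n\in\mathbb N$ let $\mathscr M^0_n$ be the set of simple Monge matrices of size $(n+1)\times(n+1)$, i.e. of matrices $A\in\mathbb N^{(n+1)\times(n+1)}$ with $A_{ij}+A_{IJ}\le A_{iJ}+A_{Ij}$ for all $i<I$ and $j<J$, and with all entries of the leftmost column and of the bottommost row equal to $0$. Let $$\mathscr M^0_\infty=\Big(\bigcup_{n\ge 0}\mathscr M^0_n\Big)\Big/\sim,$$ where $A\sim B$ if $A=\left[\begin{smallmatrix}0&B\\0&0\end{smallmatrix}\right]$ or $B=\left[\begin{smallmatrix}0&A\\0&0\end{smallmatrix}\right]$ (with zero blocks of any size, possibly empty). The norm $\|A\|_{1,1}=\sum_{i,j}A_{ij}$ depends only on the class $\overline A$ of $A$; for $k\in\mathbb N$ put $$\mathscr G^k_{1,1}(\infty)=\{\overline A\in\mathscr M^0_\infty:\ \|\overline A\|_{1,1}=k\}.$$ **Proposition 3.8.** For every $k\in\mathbb N$ the set $\mathscr G^k_{1,1}(\infty)$ is finite, and its number of elements is equal to each of the following: 1. the number of partitions of $k$ when there are $d(a)$ different copies of each part $a=1,2,\dots$,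 where $d(a)$ is the number of divisors of $a$ (that is, of finite multisets of pairs $(a,c)$ with $a\ge1$ and $1\le c\le d(a)$ in which the first coordinates sum to $k$); 2. the number of factorization patterns of $k$, that is, of the multisets of pairs that occur as the factorization pattern of a monic polynomial of degree $k$ over some finite field; here the factorization pattern of a monic polynomial $f=\prod_{i=1}^r g_i^{e_i}$, with $g_1,\dots,g_r$ distinct monic irreducible polynomials and $e_1,\dots,e_r\ge1$, is the multiset $\{(\deg g_1,e_1),\dots,(\deg g_r,e_r)\}$; 3. the number of partitions of $k$ with unlimited distinguishable but unlabeled parts of each size, that is, of finite multisets of pairs $a_{(j)}=(a,j)$ of integers $a,j\ge1$, in which the numbers $a$ sum to $k$ and in which, for all $a,j\ge 1$, the number of occurrences of $a_{(j)}$ is at least the number of occurrences of $a_{(j+1)}$; 4. the number of unital $*$-subalgebras of the algebra $M_k(\mathbb C)$ of $k\times k$ complex matrices, up to unitary similarity. (A unital $*$-subalgebra is a linear subspace that is closed under multiplication and conjugate transpose and that contains the identity matrix; $\mathcal A$ and $\mathcal B$ are unitarily similar if $\mathcal B=U\mathcal A U^*$ for some unitary matrix $U$.) -/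

import Mathlib

namespace SimpleMonge

/-- The Monge property of an `(n+1) × (n+1)` matrix with entries in `ℕ`
(rows and columns are numbered from `0` to `n`). -/
def IsMonge {n : ℕ} (A : Matrix (Fin (n + 1)) (Fin (n + 1)) ℕ) : Prop :=
  ∀ i I j J : Fin (n + 1), i < I → j < J → A i j + A I J ≤ A i J + A I j

/-- A Monge matrix is simple if its bottommost row and its leftmost column vanish. -/
def IsSimpleMonge {n : ℕ} (A : Matrix (Fin (n + 1)) (Fin (n + 1)) ℕ) : Prop :=
  IsMonge A ∧ ∀ i j : Fin (n + 1), i = Fin.last n ∨ j = 0 → A i j = 0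

/-- The set of simple Monge matrices of size `(n+1) × (n+1)`, as a type. -/
def M0 (n : ℕ) : Type :=
  {A : Matrix (Fin (n + 1)) (Fin (n + 1)) ℕ // IsSimpleMonge A}

/-- The `L_{1,1}` norm of a matrix with entries in `ℕ`: the sum of all entries. -/
def norm11 {n : ℕ} (A : Matrix (Fin (n + 1)) (Fin (n + 1)) ℕ) : ℕ :=
  ∑ i, ∑ j, A i j

/-- For `m ≤ n`, the `(n+1) × (n+1)` block matrix `[0 B; 0 0]`, in which the
`(m+1) × (m+1)` matrix `B` occupies the upper right corner. -/
def pad {m : ℕ} (n : ℕ) (B : Matrix (Fin (m + 1)) (Fin (m + 1)) ℕ) :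
    Matrix (Fin (n + 1)) (Fin (n + 1)) ℕ :=
  fun i j =>
    if h : (i : ℕ) ≤ m ∧ n - m ≤ (j : ℕ) then
      B ⟨i, by omega⟩ ⟨(j : ℕ) - (n - m), by omega⟩
    else 0

/-- `IsPad A B` says that `A` is the block matrix `[0 B; 0 0]` (with zero blocks of any
size, possibly empty). -/
def IsPad (A B : Σ n : ℕ, M0 n) : Prop :=
  B.1 ≤ A.1 ∧ A.2.1 = pad A.1 B.2.1

/-- Auxiliary: the entry of `A` in row `i` and in column `j` counted from the right (both
starting from `0`), extended by zero. -/
def corner {n : ℕ} (A : Matrix (Fin (n + 1)) (Fin (n + 1)) ℕ) (i j : ℕ) : ℕ :=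
  if h : i ≤ n ∧ j ≤ n then A ⟨i, by omega⟩ ⟨n - j, by omega⟩ else 0

theorem isPad_iff (A B : Σ n : ℕ, M0 n) :
    IsPad A B ↔ B.1 ≤ A.1 ∧ corner A.2.1 = corner B.2.1 := by
  obtain ⟨n, A, hA⟩ := A
  obtain ⟨m, B, hB⟩ := B
  simp only [IsPad]
  refine and_congr_right fun hmn => ⟨fun h => ?_, fun h => ?_⟩
  · funext i j
    subst h
    simp only [corner, pad]
    split_ifs with h1 h2 h3 h4 h5
    · congr 2
      omega
    · omega
    · omega
    · rfl
    · omega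
    · rfl
  · funext i j
    have hij := congrFun (congrFun h i) (n - j)
    have hi := i.2
    have hj := j.2
    have e1 : n - (n - (j : ℕ)) = j := by omega
    simp only [corner, e1] at hij
    rw [dif_pos (by omega)] at hij
    simp only [pad]
    refine hij.trans ?_
    split_ifs with h1 h2 h3
    · congr 2
      omega
    · omega
    · omega
    · rfl

/-- The equivalence relation identifying `B` with `[0 B; 0 0]`. -/
def padSetoid : Setoid (Σ n : ℕ, M0 n) where
  r A B := IsPad A B ∨ IsPad B A
  iseqv := by
    have key : ∀ A B : Σ n : ℕ, M0 n,
        (IsPad A B ∨ IsPad B A) ↔ corner A.2.1 = corner B.2.1 := by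
      intro A B
      rw [isPad_iff, isPad_iff]
      constructor
      · rintro (h | h)
        · exact h.2
        · exact h.2.symm
      · intro h
        rcases le_total B.1 A.1 with h' | h'
        · exact Or.inl ⟨h', h⟩
        · exact Or.inr ⟨h', h.symm⟩
    refine ⟨fun A => (key A A).2 rfl, fun {A B} h => Or.symm h, fun {A B C} h1 h2 => ?_⟩
    exact (key A C).2 (((key A B).1 h1).trans ((key B C).1 h2))

/-- The set of simple Monge matrices of arbitrary dimension. -/
def M0Infty : Type := Quotient padSetoid

theorem norm11_eq_sum_corner {n N : ℕ} (A : Matrix (Fin (n + 1)) (Fin (n + 1)) ℕ)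
    (h : n ≤ N) :
    norm11 A = ∑ i ∈ Finset.range (N + 1), ∑ j ∈ Finset.range (N + 1), corner A i j := by
  have hsub : Finset.range (n + 1) ⊆ Finset.range (N + 1) :=
    Finset.range_subset_range.2 (by omega)
  have h1 : ∀ i, ∑ j ∈ Finset.range (N + 1), corner A i j
      = ∑ j ∈ Finset.range (n + 1), corner A i j := by
    intro i
    refine (Finset.sum_subset hsub fun j _ hj => ?_).symm
    rw [Finset.mem_range] at hj
    exact dif_neg (by omega)
  simp only [h1]
  have h2 : ∑ i ∈ Finset.range (N + 1), ∑ j ∈ Finset.range (n + 1), corner A i j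
      = ∑ i ∈ Finset.range (n + 1), ∑ j ∈ Finset.range (n + 1), corner A i j := by
    refine (Finset.sum_subset hsub fun i _ hi => ?_).symm
    rw [Finset.mem_range] at hi
    exact Finset.sum_eq_zero fun j _ => dif_neg (by omega)
  rw [h2, Finset.sum_range]
  unfold norm11
  refine Finset.sum_congr rfl fun i _ => ?_
  rw [← Finset.sum_range_reflect, Finset.sum_range]
  refine Finset.sum_congr rfl fun j _ => ?_
  have hi := i.2
  have hj := j.2
  unfold corner
  rw [dif_pos (by omega)]
  congr 1
  ext
  simp only
  omega

theorem norm11_eq_of_isPad {A B : Σ n : ℕ, M0 n} (h : IsPad A B) :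
    norm11 A.2.1 = norm11 B.2.1 := by
  rw [isPad_iff] at h
  rw [norm11_eq_sum_corner A.2.1 le_rfl, norm11_eq_sum_corner B.2.1 h.1, h.2]

/-- The `L_{1,1}` norm on simple Monge matrices of arbitrary dimension. -/
def norm11Infty : M0Infty → ℕ :=
  Quotient.lift (s := padSetoid) (fun A => norm11 A.2.1) (by
    rintro A B (h | h)
    · exact norm11_eq_of_isPad h
    · exact (norm11_eq_of_isPad h).symm)

/-- The simple Monge matrices of arbitrary dimension with `L_{1,1}` norm `k`. -/
def G11Infty (k : ℕ) : Set M0Infty := {a | norm11Infty a = k}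

/-- The partitions of `k` in which each part `a` comes in `d(a)` different copies, as finite
multisets of parts `⟨a, c⟩` with size `a` and copy number `c`. There is no part of size `0`,
because `Nat.divisors 0 = ∅`. -/
def divisorPartitions (k : ℕ) : Set (Multiset (Σ a : ℕ, Fin (Nat.divisors a).card)) :=
  {π | (π.map fun p => p.1).sum = k}

open Classical in
/-- The factorization pattern of a nonzero polynomial `f` over a field: the multiset of the
pairs `(deg g, e)`, where `g` runs over the distinct monic irreducible factors of `f` and `e`
is the exponent of `g` in the factorization of `f`. -/
noncomputable def factorizationPattern {F : Type} [Field F] (f : Polynomial F) :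
    Multiset (ℕ × ℕ) :=
  (UniqueFactorizationMonoid.normalizedFactors f).toFinset.val.map fun g =>
    (g.natDegree, (UniqueFactorizationMonoid.normalizedFactors f).count g)

/-- The factorization patterns of `k`: those of the monic polynomials of degree `k` over
finite fields. -/
def factorizationPatterns (k : ℕ) : Set (Multiset (ℕ × ℕ)) :=
  {P | ∃ (F : Type) (_ : Field F) (_ : Finite F) (f : Polynomial F),
    f.Monic ∧ f.natDegree = k ∧ factorizationPattern f = P}

/-- The partitions of `k` with unlimited distinguishable but unlabeled parts of each size: the
occurrences of each part `a` are decorated with subscripts `j = 1, 2, …`, so that the partition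
is a finite multiset of pairs `(a, j)`, and the number of occurrences of `(a, j)` is at least
that of `(a, j + 1)`. -/
def unlabeledPartitions (k : ℕ) : Set (Multiset (ℕ × ℕ)) :=
  {ρ | (∀ p ∈ ρ, 1 ≤ p.1 ∧ 1 ≤ p.2) ∧
    (∀ a j : ℕ, 1 ≤ a → 1 ≤ j → ρ.count (a, j + 1) ≤ ρ.count (a, j)) ∧
    (ρ.map fun p => p.1).sum = k}

/-- Unitary similarity of unital *-subalgebras of the `k × k` complex matrices:
`B = U A U*` for some unitary matrix `U`. -/
def unitarySimilarity (k : ℕ) : Setoid (StarSubalgebra ℂ (Matrix (Fin k) (Fin k) ℂ)) where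
  r A B := ∃ U ∈ Matrix.unitaryGroup (Fin k) ℂ,
    (B : Set (Matrix (Fin k) (Fin k) ℂ)) =
      (fun X => U * X * star U) '' (A : Set (Matrix (Fin k) (Fin k) ℂ))
  iseqv := by
    refine ⟨fun A => ⟨1, one_mem _, by simp⟩, ?_, ?_⟩
    · rintro A B ⟨U, hU, h⟩
      refine ⟨star U, Unitary.star_mem hU, ?_⟩
      rw [h, Set.image_image]
      have e : ∀ X : Matrix (Fin k) (Fin k) ℂ,
          star U * (U * X * star U) * star (star U) = X := by
        intro X
        have h1 : star U * U = 1 := (Unitary.mem_iff.1 hU).1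
        calc star U * (U * X * star U) * star (star U)
            = (star U * U) * X * (star U * U) := by
              rw [star_star]; simp only [mul_assoc]
          _ = X := by rw [h1, one_mul, mul_one]
      simp only [e, Set.image_id']
    · rintro A B C ⟨U, hU, h⟩ ⟨V, hV, h'⟩
      refine ⟨V * U, mul_mem hV hU, ?_⟩
      rw [h', h, Set.image_image]
      simp only [star_mul, mul_assoc]

end SimpleMonge

namespace SimpleMonge

/-! All five families are counted by the same objects, the finite multisets of pairs `(a, b)` of
positive integers with products summing to `k`, so each family is compared with `pairPartitions k`
and not with the others.

A copy of the part `m` is a factorization `m = a * b`. For unlabeled parts, the second entries `b`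
paired with a fixed `a` form a partition; its conjugate records how often each `(a, j)` occurs, and
decreases in `j`. A simple Monge matrix is a unique sum of all-ones rectangles in the upper right
corner: its mixed second differences are nonnegative by the Monge property and count the `a × b`
rectangles, each of which adds `a * b` to the norm. Indexing from that corner makes padding
invisible.

For polynomials, degree is the sum of factor degree times exponent. Conversely, every pattern occurs
once the field has enough irreducibles of each degree, which a root count in `GaloisField p d` with
large `p` provides (`exists_irreducible_notMem`).

A unital `*`-subalgebra splits `ℂ^k` into orthogonal simple modules. By Schur's lemma isomorphic
summands are isometric (`exists_isometric_intertwiner`), so suitable orthonormal bases make the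
algebra block diagonal with equal blocks on isomorphic summands; Jacobson density shows that all
such matrices occur (`exists_smul_eq_of_isotypic`). A block of size `n` repeated `m` times gives the
pair `(n, m)`. Minimal central idempotents recover the pairs: the ideal of one has dimension `n *
n`, and its trace is `n * m` (`HasBlockForm.blockPattern_eq`). Equal patterns differ only by a
reindexing of blocks, hence by a unitary. -/

/-- The multisets of pairs of positive integers whose products sum to `k`. -/
def pairPartitions (k : ℕ) : Set (Multiset (ℕ × ℕ)) :=
  {P | (∀ p ∈ P, 1 ≤ p.1 ∧ 1 ≤ p.2) ∧ (P.map fun p => p.1 * p.2).sum = k}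

theorem mul_le_of_mem_pairPartitions {k : ℕ} {P : Multiset (ℕ × ℕ)} (hP : P ∈ pairPartitions k)
    {p : ℕ × ℕ} (hp : p ∈ P) : p.1 * p.2 ≤ k := by
  rw [← hP.2]
  exact Multiset.le_sum_of_mem (Multiset.mem_map_of_mem (fun p : ℕ × ℕ => p.1 * p.2) hp)

theorem le_of_mem_pairPartitions {k : ℕ} {P : Multiset (ℕ × ℕ)} (hP : P ∈ pairPartitions k)
    {p : ℕ × ℕ} (hp : p ∈ P) : p.1 ≤ k ∧ p.2 ≤ k := by
  have h := mul_le_of_mem_pairPartitions hP hp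
  have h1 := hP.1 p hp
  constructor <;> nlinarith

/-- Each pair contributes at least `1` to the sum, so there are at most `k` pairs, all with entries
at most `k`. Hence every such multiset lies below `k` copies of a square, and a multiset has
finitely many submultisets. -/
theorem finite_pairPartitions (k : ℕ) : (pairPartitions k).Finite := by
  classical
  refine (Set.finite_Iic (k • (Finset.Icc 1 k ×ˢ Finset.Icc 1 k).val)).subset fun P hP => ?_
  rw [Set.mem_Iic, Multiset.le_iff_count]
  intro p
  by_cases hp : p ∈ P
  · have hcard : P.card ≤ k := by
      have := Multiset.card_nsmul_le_sum (s := P.map fun p => p.1 * p.2) (a := 1) (by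
        intro x hx
        obtain ⟨q, hq, rfl⟩ := Multiset.mem_map.1 hx
        exact Nat.mul_pos (hP.1 q hq).1 (hP.1 q hq).2)
      simpa [hP.2] using this
    have h1 := hP.1 p hp
    have h2 := le_of_mem_pairPartitions hP hp
    rw [Multiset.count_nsmul, Multiset.count_eq_one_of_mem (Finset.nodup _)
      (by simp [h1, h2]), mul_one]
    exact (Multiset.count_le_card _ _).trans hcard
  · rw [Multiset.count_eq_zero_of_notMem hp]
    exact Nat.zero_le _

/-! ### Partitions with `d(a)` copies of the part `a` -/

/-- A numbering of the divisors of `a` turns a copy of the part `a` into a factorization of `a`. -/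
noncomputable def divisorPair (x : Σ a : ℕ, Fin (Nat.divisors a).card) : ℕ × ℕ :=
  (((Nat.divisors x.1).equivFin.symm x.2 : ℕ), x.1 / ((Nat.divisors x.1).equivFin.symm x.2 : ℕ))

theorem divisorPair_mul (x : Σ a : ℕ, Fin (Nat.divisors a).card) :
    (divisorPair x).1 * (divisorPair x).2 = x.1 :=
  Nat.mul_div_cancel' (Nat.dvd_of_mem_divisors ((Nat.divisors x.1).equivFin.symm x.2).2)

theorem divisorPair_injective : Function.Injective divisorPair := by
  intro x y h
  have h1 : x.1 = y.1 := by rw [← divisorPair_mul, h, divisorPair_mul]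
  obtain ⟨a, c⟩ := x
  obtain ⟨b, d⟩ := y
  obtain rfl : a = b := h1
  have h2 := congrArg Prod.fst h
  simp only [divisorPair] at h2
  rw [(Nat.divisors a).equivFin.symm.injective (Subtype.ext h2)]

theorem divisorPair_pos (x : Σ a : ℕ, Fin (Nat.divisors a).card) :
    1 ≤ (divisorPair x).1 ∧ 1 ≤ (divisorPair x).2 := by
  have h := divisorPair_mul x
  have h0 : x.1 ≠ 0 :=
    (Nat.mem_divisors.1 ((Nat.divisors x.1).equivFin.symm x.2).2).2
  rw [← h] at h0
  exact ⟨Nat.pos_of_ne_zero (left_ne_zero_of_mul h0),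
    Nat.pos_of_ne_zero (right_ne_zero_of_mul h0)⟩

theorem exists_divisorPair_eq {p : ℕ × ℕ} (hp : 1 ≤ p.1 ∧ 1 ≤ p.2) : ∃ x, divisorPair x = p := by
  obtain ⟨a, b⟩ := p
  have hab : a ∈ Nat.divisors (a * b) :=
    Nat.mem_divisors.2 ⟨dvd_mul_right _ _, (Nat.mul_pos hp.1 hp.2).ne'⟩
  refine ⟨⟨a * b, (Nat.divisors (a * b)).equivFin ⟨a, hab⟩⟩, ?_⟩
  simp only [divisorPair, Equiv.symm_apply_apply]
  rw [Nat.mul_div_cancel_left _ hp.1]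

theorem encard_divisorPartitions (k : ℕ) :
    (divisorPartitions k).encard = (pairPartitions k).encard := by
  rw [← (Multiset.map_injective divisorPair_injective).encard_image]
  congr 1
  ext P
  constructor
  · rintro ⟨π, hπ, rfl⟩
    refine ⟨fun p hp => ?_, ?_⟩
    · obtain ⟨x, -, rfl⟩ := Multiset.mem_map.1 hp
      exact divisorPair_pos x
    · rw [Multiset.map_map]
      simp only [Function.comp_def, divisorPair_mul]
      exact hπ
  · rintro ⟨hpos, hsum⟩
    have : CanLift (ℕ × ℕ) (Σ a : ℕ, Fin (Nat.divisors a).card) divisorPair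
        fun p => 1 ≤ p.1 ∧ 1 ≤ p.2 := ⟨fun p hp => exists_divisorPair_eq hp⟩
    lift P to Multiset (Σ a : ℕ, Fin (Nat.divisors a).card) using hpos
    refine ⟨P, ?_, rfl⟩
    rw [Multiset.map_map] at hsum
    simp only [Function.comp_def, divisorPair_mul] at hsum
    exact hsum

/-! ### Partitions with distinguishable but unlabeled parts -/

/-- Replaces each pair `(a, e)` by the parts `(a, 1), …, (a, e)`. -/
def unlabeled (P : Multiset (ℕ × ℕ)) : Multiset (ℕ × ℕ) :=
  P.bind fun p => (Finset.Icc 1 p.2).val.map fun j => (p.1, j)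

theorem count_unlabeled (P : Multiset (ℕ × ℕ)) (a j : ℕ) :
    (unlabeled P).count (a, j) = P.countP fun p => p.1 = a ∧ 1 ≤ j ∧ j ≤ p.2 := by
  induction P using Multiset.induction with
  | empty => simp [unlabeled]
  | cons p P ih =>
    rw [unlabeled, Multiset.cons_bind, Multiset.count_add, Multiset.countP_cons, ← ih, unlabeled,
      add_comm]
    congr 1
    rw [Multiset.count_map]
    split_ifs with h
    · obtain ⟨rfl, h1, h2⟩ := h
      rw [← Multiset.countP_eq_card_filter]
      have := Multiset.count_eq_one_of_mem (Finset.Icc 1 p.2).nodup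
        (show j ∈ (Finset.Icc 1 p.2).val by simp [h1, h2])
      simpa [Multiset.count] using this
    · rw [Multiset.card_eq_zero, Multiset.filter_eq_nil]
      intro x hx he
      have : 1 ≤ x ∧ x ≤ p.2 := by simpa using hx
      simp only [Prod.mk.injEq] at he
      exact h ⟨he.1.symm, he.2 ▸ this⟩

theorem sum_unlabeled (P : Multiset (ℕ × ℕ)) :
    ((unlabeled P).map fun p => p.1).sum = (P.map fun p => p.1 * p.2).sum := by
  induction P using Multiset.induction with
  | empty => simp [unlabeled]
  | cons p P ih =>
    rw [unlabeled, Multiset.cons_bind, Multiset.map_add, Multiset.sum_add, Multiset.map_cons,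
      Multiset.sum_cons, ← ih, unlabeled]
    congr 1
    simp [mul_comm]

/-- Part `j` comes from the pairs with second entry at least `j`; those with entry exactly `j`
account for the drop to `j + 1`. This recursion inverts `unlabeled`. -/
theorem count_unlabeled_eq_add (P : Multiset (ℕ × ℕ)) (a : ℕ) {j : ℕ} (hj : 1 ≤ j) :
    (unlabeled P).count (a, j) = P.count (a, j) + (unlabeled P).count (a, j + 1) := by
  rw [count_unlabeled, count_unlabeled]
  induction P using Multiset.induction with
  | empty => simp
  | cons p P ih =>
    obtain ⟨b, e⟩ := p
    rw [Multiset.countP_cons, Multiset.countP_cons, Multiset.count_cons, ih]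
    simp only [Prod.mk.injEq]
    split_ifs <;> omega

/-- Descending induction from `N`. Equality of the differences is stated additively to avoid
truncated subtraction. -/
theorem eq_of_forall_eq_of_add_eq {f g : ℕ → ℕ} {m N : ℕ}
    (h : ∀ j, m ≤ j → f j + g (j + 1) = g j + f (j + 1)) (hN : ∀ j, N ≤ j → f j = g j) {j : ℕ}
    (hj : m ≤ j) : f j = g j := by
  by_cases hjN : N ≤ j
  · exact hN j hjN
  · have h1 := eq_of_forall_eq_of_add_eq h hN (j := j + 1) (hj.trans (Nat.le_succ j))
    have h2 := h j hj
    omega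
  termination_by N - j

theorem unlabeled_injOn (k : ℕ) : Set.InjOn unlabeled (pairPartitions k) := by
  intro P hP R hR h
  ext ⟨a, j⟩
  rcases Nat.eq_zero_or_pos j with rfl | hj
  · rw [Multiset.count_eq_zero_of_notMem fun hm => absurd (hP.1 _ hm).2 (by simp),
      Multiset.count_eq_zero_of_notMem fun hm => absurd (hR.1 _ hm).2 (by simp)]
  · have h1 := count_unlabeled_eq_add P a hj
    have h2 := count_unlabeled_eq_add R a hj
    rw [h] at h1
    omega

theorem exists_unlabeled_eq {k : ℕ} {ρ : Multiset (ℕ × ℕ)} (hρ : ρ ∈ unlabeledPartitions k) :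
    ∃ P : Multiset (ℕ × ℕ), (∀ p ∈ P, 1 ≤ p.1 ∧ 1 ≤ p.2) ∧ unlabeled P = ρ := by
  obtain ⟨hpos, hdec, -⟩ := hρ
  -- `σ` is `ρ` with subscripts lowered by one, so the multiplicities in `ρ - σ` are the successive
  -- drops in `ρ`; the truncated subtraction is exact because they decrease.
  set σ : Multiset (ℕ × ℕ) := (ρ.filter fun p => 1 < p.2).map fun p => (p.1, p.2 - 1) with hσ
  have hσc : ∀ a j, 1 ≤ j → σ.count (a, j) = ρ.count (a, j + 1) := by
    intro a j hj
    rw [hσ, Multiset.count_map, Multiset.filter_filter, Multiset.count,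
      Multiset.countP_eq_card_filter]
    congr 1
    refine Multiset.filter_congr ?_
    rintro ⟨b, e⟩ -
    simp only [Prod.mk.injEq]
    omega
  have hcount : ∀ a j, 1 ≤ j → (ρ - σ).count (a, j) = ρ.count (a, j) - ρ.count (a, j + 1) := by
    intro a j hj
    rw [Multiset.count_sub, hσc a j hj]
  have hP : ∀ p ∈ ρ - σ, 1 ≤ p.1 ∧ 1 ≤ p.2 :=
    fun p hp => hpos p (Multiset.mem_of_le (Multiset.sub_le_self _ _) hp)
  obtain ⟨N, hN⟩ : ∃ N, ∀ p ∈ ρ, p.2 < N :=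
    ⟨(ρ.map fun p => p.2).sum + 1, fun p hp => Nat.lt_succ_of_le
      (Multiset.le_sum_of_mem (Multiset.mem_map_of_mem (fun p : ℕ × ℕ => p.2) hp))⟩
  refine ⟨ρ - σ, hP, ?_⟩
  ext ⟨a, j⟩
  rcases Nat.eq_zero_or_pos j with rfl | hj
  · rw [count_unlabeled, Multiset.count_eq_zero_of_notMem fun hm => absurd (hpos _ hm).2 (by simp)]
    simp
  rcases Nat.eq_zero_or_pos a with rfl | ha
  · rw [count_unlabeled, Multiset.count_eq_zero_of_notMem fun hm => absurd (hpos _ hm).1 (by simp),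
      Multiset.countP_eq_zero]
    intro p hp h
    have := (hP p hp).1
    omega
  refine eq_of_forall_eq_of_add_eq (f := fun j => (unlabeled (ρ - σ)).count (a, j))
    (g := fun j => ρ.count (a, j)) (m := 1) (N := N) (fun i hi => ?_) (fun i hi => ?_) hj
  · have h1 := count_unlabeled_eq_add (ρ - σ) a hi
    have h2 := hdec a i ha hi
    have h3 := hcount a i hi
    omega
  · rw [count_unlabeled, Multiset.count_eq_zero_of_notMem fun hm => absurd (hN _ hm) (by simpa),
      Multiset.countP_eq_zero]
    intro p hp h
    have := hN p (Multiset.mem_of_le (Multiset.sub_le_self _ _) hp)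
    omega

theorem encard_unlabeledPartitions (k : ℕ) :
    (unlabeledPartitions k).encard = (pairPartitions k).encard := by
  rw [← (unlabeled_injOn k).encard_image]
  congr 1
  ext ρ
  constructor
  · intro hρ
    obtain ⟨P, hP, rfl⟩ := exists_unlabeled_eq hρ
    exact ⟨P, ⟨hP, by rw [← sum_unlabeled, hρ.2.2]⟩, rfl⟩
  · rintro ⟨P, hP, rfl⟩
    refine ⟨fun p hp => ?_, fun a j _ hj => ?_, by rw [sum_unlabeled, hP.2]⟩
    · obtain ⟨q, hq, hpq⟩ := Multiset.mem_bind.1 hp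
      obtain ⟨j, hj, rfl⟩ := Multiset.mem_map.1 hpq
      have : 1 ≤ j ∧ j ≤ q.2 := by simpa using hj
      exact ⟨(hP.1 q hq).1, this.1⟩
    · rw [count_unlabeled_eq_add P a hj]
      omega

/-! ### Simple Monge matrices and their densities -/

/-- The entry of the simple Monge matrix of density `P`, in row `i` and in column `j` counted from
the right. -/
def cornerOfDensity (P : Multiset (ℕ × ℕ)) (i j : ℕ) : ℕ :=
  P.countP fun p => i < p.1 ∧ j < p.2

/-- The mixed second difference of the indicator of an `a × b` corner rectangle is the unit mass at
its extreme cell, whose zero-based position is `(a - 1, b - 1)`. -/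
theorem cornerOfDensity_add (P : Multiset (ℕ × ℕ)) (i j : ℕ) :
    cornerOfDensity P i j + cornerOfDensity P (i + 1) (j + 1) =
      cornerOfDensity P i (j + 1) + cornerOfDensity P (i + 1) j + P.count (i + 1, j + 1) := by
  unfold cornerOfDensity
  induction P using Multiset.induction with
  | empty => simp
  | cons p P ih =>
    obtain ⟨b, e⟩ := p
    simp only [Multiset.countP_cons, Multiset.count_cons, Prod.mk.injEq]
    split_ifs <;> omega

/-- It suffices to check a single rectangle. The inequality is reversed relative to `IsMonge`
because columns are counted from the right. -/
theorem cornerOfDensity_monge (P : Multiset (ℕ × ℕ)) {i I j J : ℕ} (hi : i < I) (hj : j < J) :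
    cornerOfDensity P i J + cornerOfDensity P I j ≤
      cornerOfDensity P i j + cornerOfDensity P I J := by
  unfold cornerOfDensity
  induction P using Multiset.induction with
  | empty => simp
  | cons p P ih =>
    simp only [Multiset.countP_cons]
    split_ifs <;> omega

theorem cornerOfDensity_eq_zero {P : Multiset (ℕ × ℕ)} {n : ℕ} (hP : ∀ p ∈ P, p.1 ≤ n ∧ p.2 ≤ n)
    {i j : ℕ} (hij : n ≤ i ∨ n ≤ j) : cornerOfDensity P i j = 0 := by
  rw [cornerOfDensity, Multiset.countP_eq_zero]
  intro p hp h
  have := hP p hp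
  omega

theorem sum_cornerOfDensity {P : Multiset (ℕ × ℕ)} {n : ℕ} (hP : ∀ p ∈ P, p.1 ≤ n ∧ p.2 ≤ n) :
    ∑ i ∈ Finset.range n, ∑ j ∈ Finset.range n, cornerOfDensity P i j =
      (P.map fun p => p.1 * p.2).sum := by
  induction P using Multiset.induction with
  | empty => simp [cornerOfDensity]
  | cons p P ih =>
    obtain ⟨h1, h2⟩ := hP p (Multiset.mem_cons_self _ _)
    rw [Multiset.map_cons, Multiset.sum_cons,
      ← ih fun q hq => hP q (Multiset.mem_cons_of_mem hq)]
    simp only [cornerOfDensity, Multiset.countP_cons, Finset.sum_add_distrib]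
    rw [add_comm]
    congr 1
    have h : ∀ i j : ℕ, (if i < p.1 ∧ j < p.2 then 1 else 0) =
        (if i < p.1 then 1 else 0) * (if j < p.2 then 1 else 0) := by
      intro i j
      split_ifs <;> first | rfl | omega
    have hc : ∀ a, a ≤ n → ∑ i ∈ Finset.range n, (if i < a then 1 else 0) = a := by
      intro a ha
      rw [← Finset.card_filter]
      have : (Finset.range n).filter (· < a) = Finset.range a := by
        ext x
        simp only [Finset.mem_filter, Finset.mem_range]
        omega
      rw [this, Finset.card_range]
    simp only [h, ← Finset.mul_sum, ← Finset.sum_mul]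
    rw [hc _ h1, hc _ h2]

theorem cornerOfDensity_injOn (k : ℕ) : Set.InjOn cornerOfDensity (pairPartitions k) := by
  intro P hP R hR h
  ext ⟨a, b⟩
  rcases Nat.eq_zero_or_pos a with rfl | ha
  · rw [Multiset.count_eq_zero_of_notMem fun hm => absurd (hP.1 _ hm).1 (by simp),
      Multiset.count_eq_zero_of_notMem fun hm => absurd (hR.1 _ hm).1 (by simp)]
  rcases Nat.eq_zero_or_pos b with rfl | hb
  · rw [Multiset.count_eq_zero_of_notMem fun hm => absurd (hP.1 _ hm).2 (by simp),
      Multiset.count_eq_zero_of_notMem fun hm => absurd (hR.1 _ hm).2 (by simp)]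
  obtain ⟨i, rfl⟩ := Nat.exists_eq_add_of_le' ha
  obtain ⟨j, rfl⟩ := Nat.exists_eq_add_of_le' hb
  have h1 := cornerOfDensity_add P i j
  have h2 := cornerOfDensity_add R i j
  rw [h] at h1
  show P.count (i + 1, j + 1) = R.count (i + 1, j + 1)
  omega

/-- The value at a cell is determined by the mixed difference and the three neighbours farther from
the corner, so agreement outside the square propagates inward. -/
theorem eq_of_mixed_difference_eq {f g : ℕ → ℕ → ℕ} {n : ℕ}
    (h : ∀ i j, f i j + f (i + 1) (j + 1) + (g i (j + 1) + g (i + 1) j) =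
      g i j + g (i + 1) (j + 1) + (f i (j + 1) + f (i + 1) j))
    (hf : ∀ i j, n ≤ i ∨ n ≤ j → f i j = g i j) (i j : ℕ) : f i j = g i j := by
  by_cases hij : n ≤ i ∨ n ≤ j
  · exact hf i j hij
  · have h1 := eq_of_mixed_difference_eq h hf (i + 1) (j + 1)
    have h2 := eq_of_mixed_difference_eq h hf i (j + 1)
    have h3 := eq_of_mixed_difference_eq h hf (i + 1) j
    have h4 := h i j
    omega
  termination_by (n - i) + (n - j)

theorem corner_eq_zero {n : ℕ} {A : Matrix (Fin (n + 1)) (Fin (n + 1)) ℕ} (hA : IsSimpleMonge A)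
    {i j : ℕ} (hij : n ≤ i ∨ n ≤ j) : corner A i j = 0 := by
  unfold corner
  split_ifs with h
  · refine hA.2 _ _ ?_
    rcases hij with hi | hj
    · left
      ext
      simp only [Fin.val_last]
      omega
    · right
      ext
      simp only [Fin.val_zero]
      omega
  · rfl

theorem corner_monge {n : ℕ} {A : Matrix (Fin (n + 1)) (Fin (n + 1)) ℕ} (hA : IsSimpleMonge A)
    (i j : ℕ) :
    corner A i (j + 1) + corner A (i + 1) j ≤ corner A i j + corner A (i + 1) (j + 1) := by
  by_cases h : i + 1 ≤ n ∧ j + 1 ≤ n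
  · have := hA.1 ⟨i, by omega⟩ ⟨i + 1, by omega⟩ ⟨n - (j + 1), by omega⟩ ⟨n - j, by omega⟩
      (by simp) (by simp only [Fin.mk_lt_mk]; omega)
    unfold corner
    rw [dif_pos (by omega), dif_pos (by omega), dif_pos (by omega), dif_pos (by omega)]
    exact this
  · rw [corner_eq_zero hA (i := i + 1) (j := j + 1) (by omega)]
    by_cases hi : n ≤ i
    · rw [corner_eq_zero hA (i := i) (j := j + 1) (by omega),
        corner_eq_zero hA (i := i + 1) (j := j) (by omega)]
      omega
    · rw [corner_eq_zero hA (i := i) (j := j + 1) (by omega),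
        corner_eq_zero hA (i := i + 1) (j := j) (by omega)]
      omega

theorem exists_cornerOfDensity_eq {n : ℕ} {A : Matrix (Fin (n + 1)) (Fin (n + 1)) ℕ}
    (hA : IsSimpleMonge A) :
    ∃ P : Multiset (ℕ × ℕ), (∀ p ∈ P, (1 ≤ p.1 ∧ 1 ≤ p.2) ∧ p.1 ≤ n ∧ p.2 ≤ n) ∧
      cornerOfDensity P = corner A := by
  set f := corner A with hf
  -- The density: `corner_monge` ensures that the natural-number subtraction loses nothing.
  set d : ℕ × ℕ → ℕ := fun x =>
    f x.1 x.2 + f (x.1 + 1) (x.2 + 1) - (f x.1 (x.2 + 1) + f (x.1 + 1) x.2) with hd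
  set P : Multiset (ℕ × ℕ) := ∑ x ∈ Finset.range n ×ˢ Finset.range n,
    Multiset.replicate (d x) (x.1 + 1, x.2 + 1) with hP
  have hmem : ∀ p ∈ P, (1 ≤ p.1 ∧ 1 ≤ p.2) ∧ p.1 ≤ n ∧ p.2 ≤ n := by
    intro p hp
    obtain ⟨x, hx, hpx⟩ := Multiset.mem_sum.1 hp
    obtain rfl := Multiset.eq_of_mem_replicate hpx
    simp only [Finset.mem_product, Finset.mem_range] at hx
    simp only
    omega
  have hcount : ∀ i j, P.count (i + 1, j + 1) = d (i, j) := by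
    intro i j
    rw [hP, Multiset.count_sum']
    simp only [Multiset.count_replicate, Prod.mk.injEq, add_left_inj]
    by_cases hij : i < n ∧ j < n
    · rw [Finset.sum_eq_single (i, j)]
      · simp
      · rintro ⟨a, b⟩ - hab
        rw [if_neg]
        rintro ⟨rfl, rfl⟩
        exact hab rfl
      · simp [hij]
    · rw [Finset.sum_eq_zero]
      · have h1 : f i j = 0 := corner_eq_zero hA (by omega)
        have h2 : f (i + 1) (j + 1) = 0 := corner_eq_zero hA (by omega)
        simp only [hd, h1, h2]
        omega
      · rintro ⟨a, b⟩ hab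
        simp only [Finset.mem_product, Finset.mem_range] at hab
        rw [if_neg]
        omega
  refine ⟨P, hmem, ?_⟩
  funext i j
  refine eq_of_mixed_difference_eq (n := n) (fun i j => ?_) (fun i j hij => ?_) i j
  · have h1 := cornerOfDensity_add P i j
    rw [hcount] at h1
    have h2 : f i (j + 1) + f (i + 1) j ≤ f i j + f (i + 1) (j + 1) := corner_monge hA i j
    simp only [hd] at h1
    omega
  · rw [cornerOfDensity_eq_zero (fun p hp => (hmem p hp).2) hij, hf, corner_eq_zero hA hij]

/-- The simple Monge matrix with density `P`. -/
def matrixOfDensity (n : ℕ) (P : Multiset (ℕ × ℕ)) : Matrix (Fin (n + 1)) (Fin (n + 1)) ℕ :=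
  fun i j => cornerOfDensity P i (n - j)

theorem isSimpleMonge_matrixOfDensity {n : ℕ} {P : Multiset (ℕ × ℕ)}
    (hP : ∀ p ∈ P, p.1 ≤ n ∧ p.2 ≤ n) : IsSimpleMonge (matrixOfDensity n P) := by
  refine ⟨fun i I j J hi hj => ?_, fun i j hij => cornerOfDensity_eq_zero hP ?_⟩
  · have := cornerOfDensity_monge P (i := i) (I := I) (j := n - J) (J := n - j) hi
      (by have := J.2; have : (j : ℕ) < J := hj; omega)
    unfold matrixOfDensity
    omega
  · rcases hij with rfl | rfl <;> simp

theorem corner_matrixOfDensity {n : ℕ} {P : Multiset (ℕ × ℕ)}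
    (hP : ∀ p ∈ P, p.1 ≤ n ∧ p.2 ≤ n) : corner (matrixOfDensity n P) = cornerOfDensity P := by
  funext i j
  unfold corner
  split_ifs with h
  · simp only [matrixOfDensity]
    congr 1
    omega
  · exact (cornerOfDensity_eq_zero hP (by omega)).symm

theorem norm11_eq_sum {n : ℕ} {A : Matrix (Fin (n + 1)) (Fin (n + 1)) ℕ} {P : Multiset (ℕ × ℕ)}
    (hP : ∀ p ∈ P, p.1 ≤ n ∧ p.2 ≤ n) (h : cornerOfDensity P = corner A) :
    norm11 A = (P.map fun p => p.1 * p.2).sum := by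
  rw [norm11_eq_sum_corner A le_rfl, ← h]
  exact sum_cornerOfDensity fun p hp => ⟨(hP p hp).1.trans n.le_succ, (hP p hp).2.trans n.le_succ⟩

/-- The corner function of a simple Monge matrix of arbitrary dimension. -/
def cornerInfty : M0Infty → ℕ → ℕ → ℕ :=
  Quotient.lift (s := padSetoid) (fun A => corner A.2.1) (by
    rintro A B (h | h)
    · exact ((isPad_iff A B).1 h).2
    · exact ((isPad_iff B A).1 h).2.symm)

theorem cornerInfty_injective : Function.Injective cornerInfty := by
  intro a b
  induction a using Quotient.inductionOn with | _ A
  induction b using Quotient.inductionOn with | _ B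
  intro h
  refine Quotient.sound ?_
  rcases le_total B.1 A.1 with h' | h'
  · exact Or.inl ((isPad_iff A B).2 ⟨h', h⟩)
  · exact Or.inr ((isPad_iff B A).2 ⟨h', h.symm⟩)

theorem encard_G11Infty (k : ℕ) : (G11Infty k).encard = (pairPartitions k).encard := by
  rw [← (cornerOfDensity_injOn k).encard_image, ← cornerInfty_injective.encard_image]
  congr 1
  ext f
  constructor
  · rintro ⟨a, ha, rfl⟩
    induction a using Quotient.inductionOn with | _ A
    obtain ⟨n, A, hA⟩ := A
    obtain ⟨P, hP, hPA⟩ := exists_cornerOfDensity_eq hA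
    refine ⟨P, ⟨fun p hp => (hP p hp).1, ?_⟩, hPA⟩
    rw [← norm11_eq_sum (fun p hp => (hP p hp).2) hPA]
    exact ha
  · rintro ⟨P, hP, rfl⟩
    have hk : ∀ p ∈ P, p.1 ≤ k ∧ p.2 ≤ k := fun p hp => le_of_mem_pairPartitions hP hp
    refine ⟨Quotient.mk padSetoid ⟨k, matrixOfDensity k P, isSimpleMonge_matrixOfDensity hk⟩, ?_,
      corner_matrixOfDensity hk⟩
    have := norm11_eq_sum hk (corner_matrixOfDensity hk).symm
    rw [hP.2] at this
    exact this

/-! ### Factorization patterns -/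

open Polynomial UniqueFactorizationMonoid in
theorem natDegree_eq_sum_normalizedFactors {F : Type} [Field F] [DecidableEq F] {f : F[X]}
    (hf : f ≠ 0) : f.natDegree = ((normalizedFactors f).map natDegree).sum := by
  rw [← natDegree_multiset_prod _ (zero_notMem_normalizedFactors f)]
  exact (natDegree_eq_of_degree_eq
    (degree_eq_degree_of_associated (prod_normalizedFactors hf))).symm

open Polynomial UniqueFactorizationMonoid in
theorem factorizationPattern_eq {F : Type} [Field F] [DecidableEq F] [DecidableEq F[X]] (f : F[X]) :
    factorizationPattern f = (normalizedFactors f).toFinset.val.map fun g =>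
      (g.natDegree, (normalizedFactors f).count g) := by
  unfold factorizationPattern
  congr!

open Polynomial UniqueFactorizationMonoid in
theorem factorizationPattern_mem_pairPartitions {F : Type} [Field F] {f : F[X]} (hf : f ≠ 0) :
    factorizationPattern f ∈ pairPartitions f.natDegree := by
  classical
  rw [factorizationPattern_eq]
  constructor
  · intro p hp
    obtain ⟨g, hg, rfl⟩ := Multiset.mem_map.1 hp
    have hg' : g ∈ normalizedFactors f := Multiset.mem_toFinset.1 hg
    refine ⟨(irreducible_of_normalized_factor g hg').natDegree_pos, ?_⟩
    exact Multiset.one_le_count_iff_mem.2 hg'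
  · rw [natDegree_eq_sum_normalizedFactors hf, Multiset.map_map,
      Finset.sum_multiset_map_count (normalizedFactors f)]
    exact Finset.sum_congr rfl fun g _ => mul_comm _ _

/-- The proper powers leave at least `p` elements of a field of order `p ^ d` uncovered, which is
the room needed in the next count. -/
theorem sum_pow_add_le {p : ℕ} (hp : 2 ≤ p) {d : ℕ} (hd : 1 ≤ d) :
    ∑ e ∈ Finset.Ico 1 d, p ^ e + p ≤ p ^ d := by
  induction d, hd using Nat.le_induction with
  | base => simp
  | succ d hd ih =>
    rw [Finset.sum_Ico_succ_top hd, pow_succ]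
    have : p ^ d * 2 ≤ p ^ d * p := Nat.mul_le_mul_left _ hp
    omega

open Polynomial in
-- If `T` contained all monic irreducibles of degree `d`, each element of the field of order `p ^ d`
-- would be a root of a member of `T` of degree `d`, or, when its minimal polynomial has degree `e <
-- d`, of `X ^ p ^ e - X`. The first kind has fewer than `p` elements and the second at most `p ^ d
-- - p`, which is too few.
theorem exists_irreducible_notMem (p : ℕ) [Fact p.Prime] {d : ℕ} (hd : 1 ≤ d)
    (T : Finset (ZMod p)[X]) (hT : d * T.card < p) :
    ∃ g ∉ T, g.Monic ∧ Irreducible g ∧ g.natDegree = d := by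
  classical
  by_contra! hcon
  have hp := (Fact.out : p.Prime).two_le
  let K := GaloisField p d
  have : Fintype K := Fintype.ofFinite _
  have hK : Fintype.card K = p ^ d := by
    rw [Fintype.card_eq_nat_card]
    exact GaloisField.card p d (by omega)
  have hfr : Module.finrank (ZMod p) K = d := GaloisField.finrank p (by omega)
  let φ := algebraMap (ZMod p) K
  have hcover : (Finset.univ : Finset K) ⊆
      ((T.filter fun g => g.natDegree = d).biUnion fun g => (g.map φ).roots.toFinset) ∪
        (Finset.Ico 1 d).biUnion fun e => (X ^ p ^ e - X : K[X]).roots.toFinset := by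
    intro α _
    have hint : IsIntegral (ZMod p) α := Algebra.IsIntegral.isIntegral α
    have hirr := minpoly.irreducible hint
    have hmon := minpoly.monic hint
    rw [Finset.mem_union, Finset.mem_biUnion, Finset.mem_biUnion]
    by_cases hdeg : (minpoly (ZMod p) α).natDegree = d
    · left
      have hmem : minpoly (ZMod p) α ∈ T := by
        by_contra h
        exact hcon _ h hmon hirr hdeg
      refine ⟨_, Finset.mem_filter.2 ⟨hmem, hdeg⟩, ?_⟩
      rw [Multiset.mem_toFinset, mem_roots (map_monic_ne_zero hmon), IsRoot, eval_map_algebraMap,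
        minpoly.aeval]
    · right
      have hle : (minpoly (ZMod p) α).natDegree ≤ d := by
        exact (minpoly.natDegree_le α).trans hfr.le
      have hpos := minpoly.natDegree_pos hint
      refine ⟨_, Finset.mem_Ico.2 ⟨hpos, lt_of_le_of_ne hle hdeg⟩, ?_⟩
      rw [Multiset.mem_toFinset, mem_roots (FiniteField.X_pow_card_pow_sub_X_ne_zero K
        (by omega) hp)]
      have hdvd := hirr.natDegree_dvd_iff_dvd_X_pow_card_pow_sub_X.1 dvd_rfl
      have := aeval_eq_zero_of_dvd_aeval_eq_zero hdvd (minpoly.aeval (ZMod p) α)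
      simpa using this
  have hcard := (Finset.card_le_card hcover).trans (Finset.card_union_le _ _)
  have h1 : ((T.filter fun g => g.natDegree = d).biUnion
      fun g => (g.map φ).roots.toFinset).card ≤ T.card * d := by
    refine (Finset.card_biUnion_le_card_mul _ _ d fun g hg => ?_).trans
      (Nat.mul_le_mul_right _ (Finset.card_filter_le _ _))
    calc (g.map φ).roots.toFinset.card ≤ (g.map φ).roots.card := Multiset.toFinset_card_le _
      _ ≤ (g.map φ).natDegree := card_roots' _
      _ ≤ g.natDegree := natDegree_map_le
      _ = d := (Finset.mem_filter.1 hg).2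
  have h2 : ((Finset.Ico 1 d).biUnion fun e => (X ^ p ^ e - X : K[X]).roots.toFinset).card ≤
      ∑ e ∈ Finset.Ico 1 d, p ^ e := by
    refine Finset.card_biUnion_le.trans (Finset.sum_le_sum fun e he => ?_)
    have he' : e ≠ 0 := by
      have := (Finset.mem_Ico.1 he).1
      omega
    calc (X ^ p ^ e - X : K[X]).roots.toFinset.card
        ≤ (X ^ p ^ e - X : K[X]).roots.card := Multiset.toFinset_card_le _
      _ ≤ (X ^ p ^ e - X : K[X]).natDegree := card_roots' _
      _ = p ^ e := FiniteField.X_pow_card_pow_sub_X_natDegree_eq K he' hp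
  have h3 := sum_pow_add_le hp hd
  rw [Finset.card_univ, hK] at hcard
  rw [mul_comm] at hT
  omega

open Polynomial in
-- Greedy choice: for each pair an irreducible avoiding those already chosen is added. Freshness
-- lets the exponent function be updated without disturbing earlier values.
theorem exists_distinct_irreducible {F : Type} [Field F] {N : ℕ} (P : Multiset (ℕ × ℕ))
    (hN : P.card ≤ N)
    (h : ∀ p ∈ P, ∀ T : Finset F[X], T.card < N →
      ∃ g ∉ T, g.Monic ∧ Irreducible g ∧ g.natDegree = p.1) :
    ∃ (T : Finset F[X]) (e : F[X] → ℕ), (∀ g ∈ T, g.Monic ∧ Irreducible g) ∧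
      T.val.map (fun g => (g.natDegree, e g)) = P := by
  classical
  induction P using Multiset.induction with
  | empty => exact ⟨∅, 0, by simp, rfl⟩
  | cons p P ih =>
    rw [Multiset.card_cons] at hN
    obtain ⟨T, e, hT, rfl⟩ := ih (by omega) fun q hq => h q (Multiset.mem_cons_of_mem hq)
    rw [Multiset.card_map] at hN
    obtain ⟨g, hgT, hmon, hirr, hdeg⟩ := h p (Multiset.mem_cons_self _ _) T
      (by rw [Finset.card_def]; omega)
    refine ⟨insert g T, Function.update e g p.2, ?_, ?_⟩
    · intro x hx
      rcases Finset.mem_insert.1 hx with rfl | hx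
      · exact ⟨hmon, hirr⟩
      · exact hT x hx
    · rw [Finset.insert_val_of_notMem hgT, Multiset.map_cons, Function.update_self, hdeg]
      congr 1
      refine Multiset.map_congr rfl fun x hx => ?_
      rw [Function.update_of_ne]
      rintro rfl
      exact hgT hx

open Polynomial UniqueFactorizationMonoid in
theorem exists_factorizationPattern_eq {F : Type} [Field F] (T : Finset F[X]) (e : F[X] → ℕ)
    (hT : ∀ g ∈ T, g.Monic ∧ Irreducible g) (he : ∀ g ∈ T, 1 ≤ e g) :
    ∃ f : F[X], f.Monic ∧ factorizationPattern f = T.val.map fun g => (g.natDegree, e g) := by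
  classical
  set s : Multiset F[X] := ∑ g ∈ T, Multiset.replicate (e g) g with hs
  have hmem : ∀ g ∈ s, g ∈ T := by
    intro g hg
    obtain ⟨x, hx, hgx⟩ := Multiset.mem_sum.1 hg
    rwa [Multiset.eq_of_mem_replicate hgx]
  have hcount : ∀ g ∈ T, s.count g = e g := by
    intro g hg
    rw [hs, Multiset.count_sum', Finset.sum_eq_single g]
    · simp
    · intro x _ hx
      rw [Multiset.count_replicate, if_neg hx]
    · exact fun h => absurd hg h
  have hnf : normalizedFactors s.prod = s := by
    rw [normalizedFactors_prod_eq s fun g hg => (hT g (hmem g hg)).2]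
    conv_rhs => rw [← Multiset.map_id s]
    exact Multiset.map_congr rfl fun g hg => (hT g (hmem g hg)).1.normalize_eq_self
  have hsT : s.toFinset = T := by
    ext g
    rw [Multiset.mem_toFinset]
    refine ⟨hmem g, fun hg => ?_⟩
    rw [← Multiset.one_le_count_iff_mem, hcount g hg]
    exact he g hg
  refine ⟨s.prod, ?_, ?_⟩
  · have := monic_multiset_prod_of_monic s id fun g hg => (hT g (hmem g hg)).1
    rwa [Multiset.map_id] at this
  · rw [factorizationPattern_eq, hnf, hsT]
    exact Multiset.map_congr rfl fun g hg => by rw [hcount g hg]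

theorem factorizationPatterns_eq (k : ℕ) : factorizationPatterns k = pairPartitions k := by
  ext P
  constructor
  · rintro ⟨F, _, _, f, hf, rfl, rfl⟩
    exact factorizationPattern_mem_pairPartitions hf.ne_zero
  · intro hP
    -- Degrees are at most `k` and fewer than `P.card` polynomials must be avoided at any stage, so
    -- this bound on `p` suffices for every choice.
    obtain ⟨p, hp, hpp⟩ := Nat.exists_infinite_primes (k * P.card + 1)
    have : Fact p.Prime := ⟨hpp⟩
    obtain ⟨T, e, hT, hTe⟩ := exists_distinct_irreducible (F := ZMod p) P le_rfl
      fun q hq T hTc => exists_irreducible_notMem p (hP.1 q hq).1 T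
        (by
          have := Nat.mul_le_mul (le_of_mem_pairPartitions hP hq).1 hTc.le
          omega)
    obtain ⟨f, hf, hfP⟩ := exists_factorizationPattern_eq T e hT fun g hg => by
      refine (hP.1 (g.natDegree, e g) ?_).2
      rw [← hTe]
      exact Multiset.mem_map_of_mem _ hg
    rw [hTe] at hfP
    refine ⟨ZMod p, inferInstance, inferInstance, f, hf, ?_, hfP⟩
    have := factorizationPattern_mem_pairPartitions hf.ne_zero
    rw [hfP] at this
    exact this.2.symm.trans hP.2

/-! ### Matching families of pairs -/

theorem exists_equiv_of_card_fiber_eq {α β γ : Type*} [Fintype α] [Fintype β] [DecidableEq γ]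
    (f : α → γ) (g : β → γ)
    (h : ∀ x, Fintype.card {a // f a = x} = Fintype.card {b // g b = x}) :
    ∃ σ : α ≃ β, g ∘ σ = f := by
  let e : ∀ x, {a // f a = x} ≃ {b // g b = x} := fun x => Fintype.equivOfCardEq (h x)
  refine ⟨(Equiv.sigmaFiberEquiv f).symm.trans
    ((Equiv.sigmaCongrRight e).trans (Equiv.sigmaFiberEquiv g)), ?_⟩
  funext a
  exact (e (f a) ⟨a, rfl⟩).2

theorem exists_equiv_of_map_univ_eq {α β γ : Type*} [Fintype α] [Fintype β] [DecidableEq γ]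
    (f : α → γ) (g : β → γ)
    (h : (Finset.univ : Finset α).val.map f = (Finset.univ : Finset β).val.map g) :
    ∃ σ : α ≃ β, g ∘ σ = f := by
  refine exists_equiv_of_card_fiber_eq f g fun x => ?_
  have := congrArg (Multiset.count x) h
  rw [Multiset.count_map, Multiset.count_map] at this
  rw [Fintype.card_subtype, Fintype.card_subtype, Finset.card_def, Finset.card_def,
    Finset.filter_val, Finset.filter_val]
  simpa only [eq_comm] using this

/-! ### Block algebras -/

/-- The sizes of the factors of a block algebra, with their multiplicities. -/
def blockPattern {S Q : Type} [Fintype S] [Fintype Q] [DecidableEq Q] (c : S → Q)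
    (n : Q → ℕ) : Multiset (ℕ × ℕ) :=
  (Finset.univ : Finset Q).val.map fun q => (n q, Fintype.card {w // c w = q})

theorem sum_blockPattern {S Q : Type} [Fintype S] [Fintype Q] [DecidableEq Q] (c : S → Q)
    (n : Q → ℕ) :
    ((blockPattern c n).map fun p => p.1 * p.2).sum = ∑ w, n (c w) := by
  rw [blockPattern, Multiset.map_map]
  change ∑ q, n q * Fintype.card {w // c w = q} = _
  rw [← Finset.sum_fiberwise (s := Finset.univ) (g := c)]
  refine Finset.sum_congr rfl fun q _ => ?_
  rw [Finset.sum_congr rfl (g := fun _ => n q)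
    fun w hw => by rw [(Finset.mem_filter.1 hw).2], Finset.sum_const, smul_eq_mul,
    Fintype.card_subtype, mul_comm]

section Block

open scoped Matrix

variable {S S' Q Q' : Type} [Fintype S] [DecidableEq S] [Fintype S'] [DecidableEq S']

/-- The representation of `∏ q, M_{n q}(ℂ)` by block diagonal matrices whose block `w` is a copy of
the factor of index `c w`. -/
def blockHom (c : S → Q) (n : Q → ℕ) :
    (∀ q, Matrix (Fin (n q)) (Fin (n q)) ℂ) →⋆ₐ[ℂ]
      Matrix (Σ w, Fin (n (c w))) (Σ w, Fin (n (c w))) ℂ where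
  toFun x := Matrix.blockDiagonal' fun w => x (c w)
  map_one' := Matrix.blockDiagonal'_one
  map_mul' x y := Matrix.blockDiagonal'_mul (fun w => x (c w)) (fun w => y (c w))
  map_zero' := Matrix.blockDiagonal'_zero
  map_add' x y := Matrix.blockDiagonal'_add (fun w => x (c w)) (fun w => y (c w))
  commutes' r := by
    rw [Algebra.algebraMap_eq_smul_one, Algebra.algebraMap_eq_smul_one]
    refine (Matrix.blockDiagonal'_smul r fun w =>
      (1 : Matrix (Fin (n (c w))) (Fin (n (c w))) ℂ)).trans ?_
    congr 1
    exact Matrix.blockDiagonal'_one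
  map_star' x := (Matrix.blockDiagonal'_conjTranspose fun w => x (c w)).symm

theorem blockHom_apply (c : S → Q) (n : Q → ℕ) (x : ∀ q, Matrix (Fin (n q)) (Fin (n q)) ℂ) :
    blockHom c n x = Matrix.blockDiagonal' fun w => x (c w) := rfl

theorem blockHom_injective {c : S → Q} (hc : Function.Surjective c) (n : Q → ℕ) :
    Function.Injective (blockHom c n) := by
  intro x y h
  rw [blockHom_apply, blockHom_apply] at h
  have h' := Matrix.blockDiagonal'_injective h
  funext q
  obtain ⟨w, rfl⟩ := hc q
  exact congrFun h' w

/-- `A` is the image of the block algebra of `c` and `n` in some orthonormal basis. -/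
def HasBlockForm {k : ℕ} (A : StarSubalgebra ℂ (Matrix (Fin k) (Fin k) ℂ)) (c : S → Q)
    (n : Q → ℕ) : Prop :=
  ∃ V : Matrix (Fin k) (Σ w, Fin (n (c w))) ℂ, V * Vᴴ = 1 ∧ Vᴴ * V = 1 ∧
    ∀ X, X ∈ A ↔ ∃ x, X = V * blockHom c n x * Vᴴ

theorem HasBlockForm.unitarySimilarity {k : ℕ}
    {A B : StarSubalgebra ℂ (Matrix (Fin k) (Fin k) ℂ)} {c : S → Q} {n : Q → ℕ}
    (hA : HasBlockForm A c n) (hB : HasBlockForm B c n) : unitarySimilarity k A B := by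
  obtain ⟨V, hV1, hV2, hV⟩ := hA
  obtain ⟨W, hW1, hW2, hW⟩ := hB
  have hstar : star (W * Vᴴ) = V * Wᴴ := by
    rw [Matrix.star_eq_conjTranspose, Matrix.conjTranspose_mul, Matrix.conjTranspose_conjTranspose]
  have key : ∀ Y : Matrix (Σ w, Fin (n (c w))) (Σ w, Fin (n (c w))) ℂ,
      W * Vᴴ * (V * Y * Vᴴ) * star (W * Vᴴ) = W * Y * Wᴴ := by
    intro Y
    calc W * Vᴴ * (V * Y * Vᴴ) * star (W * Vᴴ)
        = W * (Vᴴ * V) * Y * (Vᴴ * V) * Wᴴ := by rw [hstar]; simp only [Matrix.mul_assoc]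
      _ = W * Y * Wᴴ := by rw [hV2, Matrix.mul_one, Matrix.mul_one]
  refine ⟨W * Vᴴ, ?_, ?_⟩
  · rw [Matrix.mem_unitaryGroup_iff, hstar]
    calc W * Vᴴ * (V * Wᴴ) = W * (Vᴴ * V) * Wᴴ := by simp only [Matrix.mul_assoc]
      _ = 1 := by rw [hV2, Matrix.mul_one, hW1]
  · ext X
    simp only [SetLike.mem_coe, Set.mem_image, hV, hW]
    constructor
    · rintro ⟨x, rfl⟩
      exact ⟨_, ⟨x, rfl⟩, key _⟩
    · rintro ⟨_, ⟨x, rfl⟩, rfl⟩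
      exact ⟨x, key _⟩

theorem HasBlockForm.of_unitarySimilarity {k : ℕ}
    {A B : StarSubalgebra ℂ (Matrix (Fin k) (Fin k) ℂ)} {c : S → Q} {n : Q → ℕ}
    (h : SimpleMonge.unitarySimilarity k A B) (hA : HasBlockForm A c n) : HasBlockForm B c n := by
  obtain ⟨V, hV1, hV2, hV⟩ := hA
  obtain ⟨U, hU, hAB⟩ := h
  have hU1 : U * Uᴴ = 1 := Matrix.mem_unitaryGroup_iff.1 hU
  have hU2 : Uᴴ * U = 1 := Matrix.mem_unitaryGroup_iff'.1 hU
  refine ⟨U * V, ?_, ?_, fun X => ?_⟩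
  · calc U * V * (U * V)ᴴ = U * (V * Vᴴ) * Uᴴ := by
          rw [Matrix.conjTranspose_mul]; simp only [Matrix.mul_assoc]
      _ = 1 := by rw [hV1, Matrix.mul_one, hU1]
  · calc (U * V)ᴴ * (U * V) = Vᴴ * (Uᴴ * U) * V := by
          rw [Matrix.conjTranspose_mul]; simp only [Matrix.mul_assoc]
      _ = 1 := by rw [hU2, Matrix.mul_one, hV2]
  · have key : ∀ Y : Matrix (Σ w, Fin (n (c w))) (Σ w, Fin (n (c w))) ℂ,
        U * (V * Y * Vᴴ) * star U = U * V * Y * (U * V)ᴴ := by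
      intro Y
      rw [Matrix.conjTranspose_mul, Matrix.star_eq_conjTranspose]
      simp only [Matrix.mul_assoc]
    rw [← SetLike.mem_coe, hAB, Set.mem_image]
    simp only [SetLike.mem_coe, hV]
    constructor
    · rintro ⟨_, ⟨x, rfl⟩, rfl⟩
      exact ⟨x, key _⟩
    · rintro ⟨x, rfl⟩
      exact ⟨_, ⟨x, rfl⟩, key _⟩

theorem HasBlockForm.comp_left {k : ℕ} {A : StarSubalgebra ℂ (Matrix (Fin k) (Fin k) ℂ)}
    {c : S → Q} {n : Q' → ℕ} (σ : Q ≃ Q') (h : HasBlockForm A c (n ∘ σ)) :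
    HasBlockForm A (σ ∘ c) n := by
  obtain ⟨V, hV1, hV2, hV⟩ := h
  refine ⟨V, hV1, hV2, fun X => (hV X).trans ⟨?_, ?_⟩⟩
  · rintro ⟨x, rfl⟩
    -- Writing `x` as the pullback of a family `y` over `Q'` makes the two block matrices
    -- definitionally equal, with no casts between sizes.
    obtain ⟨y, rfl⟩ := (Equiv.piCongrLeft' (fun q => Matrix (Fin (n q)) (Fin (n q)) ℂ)
      σ.symm).surjective x
    exact ⟨y, rfl⟩
  · rintro ⟨x, rfl⟩
    exact ⟨fun q => x (σ q), rfl⟩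

theorem HasBlockForm.of_comp_right {k : ℕ} {A : StarSubalgebra ℂ (Matrix (Fin k) (Fin k) ℂ)}
    {c : S' → Q} {n : Q → ℕ} (τ : S ≃ S') (h : HasBlockForm A (c ∘ τ) n) :
    HasBlockForm A c n := by
  obtain ⟨V, hV1, hV2, hV⟩ := h
  let E : (Σ w, Fin (n (c (τ w)))) ≃ Σ w, Fin (n (c w)) :=
    Equiv.sigmaCongrLeft (β := fun w => Fin (n (c w))) τ
  have hblock : ∀ x, blockHom c n x = (blockHom (c ∘ τ) n x).submatrix E.symm E.symm := by
    intro x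
    rw [← Matrix.submatrix_id_id (blockHom c n x)]
    have : (id : (Σ w, Fin (n (c w))) → _) = E ∘ E.symm := by
      funext i
      simp
    rw [this, ← Matrix.submatrix_submatrix]
    congr 1
    ext ⟨w, i⟩ ⟨w', j⟩
    rw [Matrix.submatrix_apply, blockHom_apply, blockHom_apply]
    change Matrix.blockDiagonal' (fun w => x (c w)) ⟨τ w, i⟩ ⟨τ w', j⟩ = _
    by_cases hw : w = w'
    · subst hw
      rw [Matrix.blockDiagonal'_apply_eq, Matrix.blockDiagonal'_apply_eq]
      rfl
    · rw [Matrix.blockDiagonal'_apply_ne _ _ _ hw,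
        Matrix.blockDiagonal'_apply_ne _ _ _ fun h => hw (τ.injective h)]
  refine ⟨V.submatrix id E.symm, ?_, ?_, fun X => (hV X).trans (exists_congr fun x => ?_)⟩
  · rw [Matrix.conjTranspose_submatrix, Matrix.submatrix_mul_equiv, hV1]
    rfl
  · have := Matrix.submatrix_mul_equiv Vᴴ V E.symm (Equiv.refl _) E.symm
    rw [hV2, Matrix.submatrix_one_equiv] at this
    exact this
  · rw [Matrix.conjTranspose_submatrix, hblock, Matrix.submatrix_mul_equiv,
      Matrix.submatrix_mul_equiv, Matrix.submatrix_id_id]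

theorem exists_hasBlockForm (c : S → Q) (n : Q → ℕ) {k : ℕ} (hk : ∑ w, n (c w) = k) :
    ∃ A : StarSubalgebra ℂ (Matrix (Fin k) (Fin k) ℂ), HasBlockForm A c n := by
  let E : (Σ w, Fin (n (c w))) ≃ Fin k := Fintype.equivOfCardEq (by simp [Fintype.card_sigma, hk])
  let V : Matrix (Fin k) (Σ w, Fin (n (c w))) ℂ :=
    (1 : Matrix (Σ w, Fin (n (c w))) (Σ w, Fin (n (c w))) ℂ).submatrix E.symm id
  have hV1 : V * Vᴴ = 1 := by
    rw [Matrix.conjTranspose_submatrix, Matrix.conjTranspose_one]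
    have := Matrix.submatrix_mul_equiv
      (1 : Matrix (Σ w, Fin (n (c w))) (Σ w, Fin (n (c w))) ℂ)
      (1 : Matrix (Σ w, Fin (n (c w))) (Σ w, Fin (n (c w))) ℂ) E.symm (Equiv.refl _) E.symm
    rw [Matrix.mul_one, Matrix.submatrix_one_equiv] at this
    exact this
  have hV2 : Vᴴ * V = 1 := by
    rw [Matrix.conjTranspose_submatrix, Matrix.conjTranspose_one, Matrix.submatrix_mul_equiv,
      Matrix.mul_one, Matrix.submatrix_id_id]
  have hmul : ∀ x y : Matrix (Σ w, Fin (n (c w))) (Σ w, Fin (n (c w))) ℂ,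
      V * x * Vᴴ * (V * y * Vᴴ) = V * (x * y) * Vᴴ := by
    intro x y
    calc V * x * Vᴴ * (V * y * Vᴴ) = V * x * (Vᴴ * V) * y * Vᴴ := by simp only [Matrix.mul_assoc]
      _ = V * (x * y) * Vᴴ := by rw [hV2, Matrix.mul_one, Matrix.mul_assoc V]
  have hadd : ∀ x y : Matrix (Σ w, Fin (n (c w))) (Σ w, Fin (n (c w))) ℂ,
      V * x * Vᴴ + V * y * Vᴴ = V * (x + y) * Vᴴ := by
    intro x y
    rw [Matrix.mul_add, Matrix.add_mul]
  refine ⟨{ carrier := {X | ∃ x, X = V * blockHom c n x * Vᴴ}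
            mul_mem' := ?_
            add_mem' := ?_
            algebraMap_mem' := ?_
            star_mem' := ?_ }, V, hV1, hV2, fun X => Iff.rfl⟩
  · rintro _ _ ⟨x, rfl⟩ ⟨y, rfl⟩
    exact ⟨x * y, by rw [hmul, map_mul]⟩
  · rintro _ _ ⟨x, rfl⟩ ⟨y, rfl⟩
    exact ⟨x + y, by rw [hadd, map_add]⟩
  · intro r
    refine ⟨algebraMap ℂ _ r, ?_⟩
    rw [AlgHomClass.commutes, Algebra.algebraMap_eq_smul_one, Algebra.algebraMap_eq_smul_one,
      Matrix.mul_smul, Matrix.smul_mul, Matrix.mul_one, hV1]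
  · rintro _ ⟨x, rfl⟩
    refine ⟨star x, ?_⟩
    rw [map_star, Matrix.star_eq_conjTranspose, Matrix.conjTranspose_mul,
      Matrix.conjTranspose_mul, Matrix.conjTranspose_conjTranspose, Matrix.mul_assoc,
      Matrix.star_eq_conjTranspose]

variable [Fintype Q] [DecidableEq Q] [Fintype Q'] [DecidableEq Q']

/-- Equality of patterns matches the factors by a bijection `σ` preserving size and multiplicity;
equal multiplicities then give a bijection `τ` of the blocks over `σ`. -/
theorem HasBlockForm.of_blockPattern_eq {k : ℕ}
    {A : StarSubalgebra ℂ (Matrix (Fin k) (Fin k) ℂ)} {c : S → Q} {n : Q → ℕ} {c' : S' → Q'}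
    {n' : Q' → ℕ} (h : HasBlockForm A c n) (hP : blockPattern c n = blockPattern c' n') :
    HasBlockForm A c' n' := by
  obtain ⟨σ, hσ⟩ := exists_equiv_of_map_univ_eq _ _ hP
  have hn : n' ∘ σ = n := funext fun q => congrArg Prod.fst (congrFun hσ q)
  have hm : ∀ q, Fintype.card {w // c' w = σ q} = Fintype.card {w // c w = q} :=
    fun q => congrArg Prod.snd (congrFun hσ q)
  obtain ⟨τ, hτ⟩ := exists_equiv_of_card_fiber_eq (σ ∘ c) c' fun q => by
    obtain ⟨q, rfl⟩ := σ.surjective q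
    rw [hm]
    exact Fintype.card_congr (Equiv.subtypeEquivRight fun w => σ.injective.eq_iff)
  subst hn
  have := h.comp_left σ
  rw [← hτ] at this
  exact this.of_comp_right τ

theorem HasBlockForm.blockPattern_mem {k : ℕ}
    {A : StarSubalgebra ℂ (Matrix (Fin k) (Fin k) ℂ)} {c : S → Q} {n : Q → ℕ}
    (h : HasBlockForm A c n) (hc : Function.Surjective c) (hn : ∀ q, 0 < n q) :
    blockPattern c n ∈ pairPartitions k := by
  refine ⟨fun p hp => ?_, ?_⟩
  · obtain ⟨q, -, rfl⟩ := Multiset.mem_map.1 hp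
    obtain ⟨w, hw⟩ := hc q
    exact ⟨hn q, Fintype.card_pos_iff.2 ⟨⟨w, hw⟩⟩⟩
  · obtain ⟨V, hV1, hV2, -⟩ := h
    -- The traces of the two identity matrices compare `k` with the sum of the block sizes.
    have := Matrix.trace_mul_comm V Vᴴ
    rw [hV1, hV2, Matrix.trace_one, Matrix.trace_one, Nat.cast_inj, Fintype.card_fin,
      Fintype.card_sigma] at this
    rw [sum_blockPattern, this]
    simp

end Block

/-! ### Uniqueness of the block pattern -/

section Idempotent

/-- The minimal central idempotents of a ring. -/
structure IsMinimalCentralIdempotent {R : Type*} [Ring R] (e : R) : Prop where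
  ne_zero : e ≠ 0
  mul_self : e * e = e
  comm : ∀ x, e * x = x * e
  minimal : ∀ f : R, f * f = f → (∀ x, f * x = x * f) → e * f = 0 ∨ e * f = e

theorem IsMinimalCentralIdempotent.map {R R' : Type*} [Ring R] [Ring R'] (ψ : R ≃+* R') {e : R}
    (he : IsMinimalCentralIdempotent e) : IsMinimalCentralIdempotent (ψ e) where
  ne_zero := (map_ne_zero_iff ψ ψ.injective).2 he.ne_zero
  mul_self := by rw [← map_mul, he.mul_self]
  comm x := by
    obtain ⟨x, rfl⟩ := ψ.surjective x
    rw [← map_mul, he.comm, map_mul]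
  minimal f hf hf' := by
    obtain ⟨f, rfl⟩ := ψ.surjective f
    have h1 : f * f = f := ψ.injective (by rw [map_mul, hf])
    have h2 : ∀ x, f * x = x * f := fun x => ψ.injective (by rw [map_mul, map_mul, hf'])
    refine (he.minimal f h1 h2).imp (fun h => ?_) (fun h => ?_)
    · rw [← map_mul, h, map_zero]
    · rw [← map_mul, h]

theorem matrix_central_idempotent {m : Type*} [Fintype m] [DecidableEq m] {f : Matrix m m ℂ}
    (hf : f * f = f) (hf' : ∀ x, f * x = x * f) : f = 0 ∨ f = 1 := by
  have hc : f ∈ Set.center (Matrix m m ℂ) :=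
    Semigroup.mem_center_iff.2 fun x => (hf' x).symm
  rw [Matrix.center_eq_range] at hc
  obtain ⟨r, rfl⟩ := hc
  -- Scalars embed injectively only when `m` is nonempty; otherwise all matrices coincide.
  rcases isEmpty_or_nonempty m with h | h
  · exact Or.inl (Subsingleton.elim _ _)
  · rw [← map_mul] at hf
    have hr : r * r = r := Matrix.scalar_inj.1 hf
    rcases IsIdempotentElem.iff_eq_zero_or_one.1 hr with h0 | h1
    · exact Or.inl (by rw [h0, map_zero])
    · exact Or.inr (by rw [h1, map_one])

variable {Q : Type*} [DecidableEq Q] {n : Q → ℕ}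

theorem pi_mul_single (x : ∀ q, Matrix (Fin (n q)) (Fin (n q)) ℂ) (q : Q)
    (y : Matrix (Fin (n q)) (Fin (n q)) ℂ) : x * Pi.single q y = Pi.single q (x q * y) := by
  funext i
  by_cases h : i = q
  · subst h
    simp
  · simp [Pi.single_eq_of_ne h]

theorem pi_single_mul (x : ∀ q, Matrix (Fin (n q)) (Fin (n q)) ℂ) (q : Q)
    (y : Matrix (Fin (n q)) (Fin (n q)) ℂ) : Pi.single q y * x = Pi.single q (y * x q) := by
  funext i
  by_cases h : i = q
  · subst h
    simp
  · simp [Pi.single_eq_of_ne h]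

theorem pi_apply_central {f : ∀ q, Matrix (Fin (n q)) (Fin (n q)) ℂ} (hf' : ∀ x, f * x = x * f)
    (q : Q) (y : Matrix (Fin (n q)) (Fin (n q)) ℂ) : f q * y = y * f q := by
  have := congrFun (hf' (Pi.single q y)) q
  simpa using this

theorem isMinimalCentralIdempotent_iff (hn : ∀ q, 0 < n q)
    (e : ∀ q, Matrix (Fin (n q)) (Fin (n q)) ℂ) :
    IsMinimalCentralIdempotent e ↔ ∃ q, e = Pi.single q 1 := by
  constructor
  · intro he
    obtain ⟨q, hq⟩ := Function.ne_iff.1 he.ne_zero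
    have heq : e q = 1 := (matrix_central_idempotent (congrFun he.mul_self q)
      (pi_apply_central he.comm q)).resolve_left hq
    refine ⟨q, ?_⟩
    have hmul : e * Pi.single q 1 = Pi.single q 1 := by rw [pi_mul_single, heq, mul_one]
    have := he.minimal (Pi.single q 1) (by rw [pi_mul_single, Pi.single_eq_same, mul_one])
      fun x => by rw [pi_mul_single, pi_single_mul, mul_one, one_mul]
    rw [hmul] at this
    rcases this with h | h
    · have := congrFun h q
      rw [Pi.single_eq_same, Pi.zero_apply] at this
      rw [heq, this] at hq
      exact absurd rfl hq
    · exact h.symm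
  · rintro ⟨q, rfl⟩
    have : Nonempty (Fin (n q)) := ⟨⟨0, hn q⟩⟩
    refine ⟨fun h => ?_, ?_, fun x => ?_, fun f hf hf' => ?_⟩
    · have := congrFun h q
      rw [Pi.single_eq_same, Pi.zero_apply] at this
      exact one_ne_zero this
    · rw [pi_mul_single, Pi.single_eq_same, mul_one]
    · rw [pi_mul_single, pi_single_mul, mul_one, one_mul]
    · rw [pi_single_mul, one_mul]
      rcases matrix_central_idempotent (congrFun hf q) (pi_apply_central hf' q) with h | h
      · left
        rw [h, Pi.single_zero]
      · right
        rw [h]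

theorem finrank_range_mulLeft_map {R R' : Type*} [Ring R] [Ring R'] [Algebra ℂ R] [Algebra ℂ R']
    (ψ : R ≃ₐ[ℂ] R') (e : R) :
    Module.finrank ℂ (LinearMap.range (LinearMap.mulLeft ℂ (ψ e))) =
      Module.finrank ℂ (LinearMap.range (LinearMap.mulLeft ℂ e)) := by
  have : LinearMap.range (LinearMap.mulLeft ℂ (ψ e)) =
      (LinearMap.range (LinearMap.mulLeft ℂ e)).map (ψ.toLinearEquiv : R →ₗ[ℂ] R') := by
    ext y
    constructor
    · rintro ⟨x, rfl⟩
      exact ⟨e * ψ.symm x, ⟨_, rfl⟩, by simp⟩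
    · rintro ⟨_, ⟨x, rfl⟩, rfl⟩
      exact ⟨ψ x, by simp⟩
  rw [this]
  exact LinearEquiv.finrank_map_eq _ _

theorem finrank_range_mulLeft_single (q : Q) :
    Module.finrank ℂ (LinearMap.range (LinearMap.mulLeft ℂ
      (Pi.single q 1 : ∀ q, Matrix (Fin (n q)) (Fin (n q)) ℂ))) = n q * n q := by
  have : LinearMap.range (LinearMap.mulLeft ℂ
      (Pi.single q 1 : ∀ q, Matrix (Fin (n q)) (Fin (n q)) ℂ)) =
      LinearMap.range (LinearMap.single ℂ (fun q => Matrix (Fin (n q)) (Fin (n q)) ℂ) q) := by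
    ext y
    constructor
    · rintro ⟨x, rfl⟩
      exact ⟨x q, by simp [pi_single_mul]⟩
    · rintro ⟨x, rfl⟩
      exact ⟨Pi.single q x, by simp [pi_single_mul]⟩
  have hinj : Function.Injective
      (LinearMap.single ℂ (fun q => Matrix (Fin (n q)) (Fin (n q)) ℂ) q) :=
    fun x y h => Pi.single_injective q h
  rw [this, ← (LinearEquiv.ofInjective _ hinj).finrank_eq, Module.finrank_matrix]
  simp

end Idempotent

theorem sum_trace_single {S Q : Type} [Fintype S] [DecidableEq Q] (c : S → Q) (n : Q → ℕ) (q : Q) :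
    ∑ w, ((Pi.single q 1 : ∀ q, Matrix (Fin (n q)) (Fin (n q)) ℂ) (c w)).trace =
      ((n q * Fintype.card {w // c w = q} : ℕ) : ℂ) := by
  have : ∀ w, ((Pi.single q 1 : ∀ q, Matrix (Fin (n q)) (Fin (n q)) ℂ) (c w)).trace =
      if c w = q then (n q : ℂ) else 0 := by
    intro w
    split_ifs with h
    · subst h
      rw [Pi.single_eq_same, Matrix.trace_one, Fintype.card_fin]
    · rw [Pi.single_eq_of_ne h, Matrix.trace_zero]
  rw [Finset.sum_congr rfl fun w _ => this w, ← Finset.sum_filter, Finset.sum_const,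
    Fintype.card_subtype, nsmul_eq_mul, Nat.cast_mul, mul_comm]

section Block

open scoped Matrix

variable {S S' Q Q' : Type} [Fintype S] [DecidableEq S] [Fintype S'] [DecidableEq S']

theorem trace_blockHom (c : S → Q) (n : Q → ℕ) (x : ∀ q, Matrix (Fin (n q)) (Fin (n q)) ℂ) :
    (blockHom c n x).trace = ∑ w, (x (c w)).trace := by
  rw [blockHom_apply, Matrix.trace_blockDiagonal']

theorem HasBlockForm.exists_algEquiv {k : ℕ} {A : StarSubalgebra ℂ (Matrix (Fin k) (Fin k) ℂ)}
    {c : S → Q} {n : Q → ℕ} (h : HasBlockForm A c n) (hc : Function.Surjective c) :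
    ∃ α : (∀ q, Matrix (Fin (n q)) (Fin (n q)) ℂ) ≃ₐ[ℂ] A,
      ∀ x, (α x : Matrix (Fin k) (Fin k) ℂ).trace = ∑ w, (x (c w)).trace := by
  obtain ⟨V, hV1, hV2, hV⟩ := h
  have hmem : ∀ x, V * blockHom c n x * Vᴴ ∈ A := fun x => (hV _).2 ⟨x, rfl⟩
  let α : (∀ q, Matrix (Fin (n q)) (Fin (n q)) ℂ) →ₐ[ℂ] A := AlgHom.ofLinearMap
    { toFun := fun x => ⟨V * blockHom c n x * Vᴴ, hmem x⟩
      map_add' := fun x y => Subtype.ext (by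
        show V * blockHom c n (x + y) * Vᴴ = V * blockHom c n x * Vᴴ + V * blockHom c n y * Vᴴ
        rw [map_add, Matrix.mul_add, Matrix.add_mul])
      map_smul' := fun r x => Subtype.ext (by
        show V * blockHom c n (r • x) * Vᴴ = r • (V * blockHom c n x * Vᴴ)
        rw [map_smul, Matrix.mul_smul, Matrix.smul_mul]) }
    (Subtype.ext (by
      show V * blockHom c n 1 * Vᴴ = 1
      rw [map_one, Matrix.mul_one, hV1]))
    (fun x y => Subtype.ext (by
      show V * blockHom c n (x * y) * Vᴴ = V * blockHom c n x * Vᴴ * (V * blockHom c n y * Vᴴ)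
      calc V * blockHom c n (x * y) * Vᴴ = V * blockHom c n x * (Vᴴ * V) * blockHom c n y * Vᴴ := by
            rw [map_mul, hV2, Matrix.mul_one]; simp only [Matrix.mul_assoc]
        _ = _ := by simp only [Matrix.mul_assoc]))
  have hα : ∀ x, (α x : Matrix (Fin k) (Fin k) ℂ) = V * blockHom c n x * Vᴴ := fun x => rfl
  have hinj : Function.Injective α := by
    intro x y hxy
    refine blockHom_injective hc n ?_
    have h1 : V * blockHom c n x * Vᴴ = V * blockHom c n y * Vᴴ := congrArg Subtype.val hxy
    have key : ∀ z : Matrix (Σ w, Fin (n (c w))) (Σ w, Fin (n (c w))) ℂ,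
        Vᴴ * (V * z * Vᴴ) * V = z := by
      intro z
      calc Vᴴ * (V * z * Vᴴ) * V = (Vᴴ * V) * z * (Vᴴ * V) := by simp only [Matrix.mul_assoc]
        _ = z := by rw [hV2, Matrix.one_mul, Matrix.mul_one]
    rw [← key (blockHom c n x), h1, key]
  have hsurj : Function.Surjective α := by
    rintro ⟨X, hX⟩
    obtain ⟨x, rfl⟩ := (hV X).1 hX
    exact ⟨x, rfl⟩
  refine ⟨AlgEquiv.ofBijective α ⟨hinj, hsurj⟩, fun x => ?_⟩
  have hx : (AlgEquiv.ofBijective α ⟨hinj, hsurj⟩ x : Matrix (Fin k) (Fin k) ℂ) =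
      V * blockHom c n x * Vᴴ := rfl
  rw [hx, Matrix.trace_mul_comm, ← Matrix.mul_assoc, hV2,
    Matrix.one_mul, trace_blockHom]

variable [Fintype Q] [DecidableEq Q] [Fintype Q'] [DecidableEq Q']

/-- The two block forms give an isomorphism `ψ` of products of matrix algebras, which permutes the
minimal central idempotents. Dimensions of the ideals they generate fix the sizes; `ψ` also
preserves the trace inherited from the `k × k` matrices, which fixes the multiplicities. -/
theorem HasBlockForm.blockPattern_eq {k : ℕ}
    {A : StarSubalgebra ℂ (Matrix (Fin k) (Fin k) ℂ)} {c : S → Q} {n : Q → ℕ} {c' : S' → Q'}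
    {n' : Q' → ℕ} (h : HasBlockForm A c n) (hc : Function.Surjective c) (hn : ∀ q, 0 < n q)
    (h' : HasBlockForm A c' n') (hc' : Function.Surjective c') (hn' : ∀ q, 0 < n' q) :
    blockPattern c n = blockPattern c' n' := by
  obtain ⟨α, hα⟩ := h.exists_algEquiv hc
  obtain ⟨α', hα'⟩ := h'.exists_algEquiv hc'
  let ψ := α.trans α'.symm
  have htr : ∀ x, ∑ w, (ψ x (c' w)).trace = ∑ w, (x (c w)).trace := by
    intro x
    rw [← hα, ← hα']
    simp [ψ]
  have hσ : ∀ q, ∃ q', ψ (Pi.single q 1) = Pi.single q' 1 := fun q =>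
    (isMinimalCentralIdempotent_iff hn' _).1
      (((isMinimalCentralIdempotent_iff hn _).2 ⟨q, rfl⟩).map ψ.toRingEquiv)
  choose σ hσ using hσ
  have single_inj : ∀ {Q : Type} [DecidableEq Q] {n : Q → ℕ} (_ : ∀ q, 0 < n q) {q r : Q},
      (Pi.single q 1 : ∀ q, Matrix (Fin (n q)) (Fin (n q)) ℂ) = Pi.single r 1 → q = r := by
    intro Q _ n hn q r hqr
    by_contra hne
    have : Nonempty (Fin (n q)) := ⟨⟨0, hn q⟩⟩
    have := congrFun hqr q
    rw [Pi.single_eq_same, Pi.single_eq_of_ne hne] at this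
    exact one_ne_zero this
  have hbij : Function.Bijective σ := by
    constructor
    · intro q r hqr
      refine single_inj hn (ψ.injective ?_)
      rw [hσ, hσ, hqr]
    · intro q'
      obtain ⟨q, hq⟩ := (isMinimalCentralIdempotent_iff hn _).1
        (((isMinimalCentralIdempotent_iff hn' _).2 ⟨q', rfl⟩).map ψ.symm.toRingEquiv)
      refine ⟨q, single_inj hn' ?_⟩
      rw [← hσ, ← hq]
      simp
  have hnσ : ∀ q, n' (σ q) = n q := by
    intro q
    have := finrank_range_mulLeft_map ψ (Pi.single q 1)
    rw [hσ, finrank_range_mulLeft_single, finrank_range_mulLeft_single] at this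
    exact Nat.mul_self_inj.1 this
  have hmσ : ∀ q, Fintype.card {w // c' w = σ q} = Fintype.card {w // c w = q} := by
    intro q
    have := htr (Pi.single q 1)
    rw [hσ, sum_trace_single, sum_trace_single, Nat.cast_inj, hnσ] at this
    exact Nat.eq_of_mul_eq_mul_left (hn q) this
  unfold blockPattern
  rw [← Multiset.map_univ_val_equiv (Equiv.ofBijective σ hbij), Multiset.map_map]
  refine Multiset.map_congr rfl fun q _ => ?_
  simp only [Function.comp_apply, Equiv.ofBijective_apply, hnσ, hmσ]

end Block

/-! ### Representations of star rings on Hilbert spaces -/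

section StarRep

/-- A representation of a star ring on an inner product space that turns `star` into the adjoint. -/
class StarRep (R V : Type*) [Ring R] [StarRing R] [NormedAddCommGroup V] [InnerProductSpace ℂ V]
    [Module R V] : Prop where
  inner_smul (r : R) (x y : V) : inner ℂ (r • x) y = inner ℂ x (star r • y)

variable {R V W E : Type*} [Ring R] [StarRing R] [Algebra ℂ R]
  [NormedAddCommGroup V] [InnerProductSpace ℂ V] [FiniteDimensional ℂ V] [Module R V]
  [IsScalarTower ℂ R V] [StarRep R V]
  [NormedAddCommGroup W] [InnerProductSpace ℂ W] [FiniteDimensional ℂ W] [Module R W]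
  [IsScalarTower ℂ R W] [StarRep R W]
  [NormedAddCommGroup E] [InnerProductSpace ℂ E] [FiniteDimensional ℂ E] [Module R E]
  [IsScalarTower ℂ R E] [StarRep R E]

/-- The adjoint of an intertwining operator. -/
noncomputable def adjointIntertwiner (f : V →ₗ[R] W) : W →ₗ[R] V where
  toFun := LinearMap.adjoint (f.restrictScalars ℂ)
  map_add' := map_add _
  map_smul' r w := by
    refine ext_inner_right ℂ fun v => ?_
    rw [RingHom.id_apply, LinearMap.adjoint_inner_left, StarRep.inner_smul, StarRep.inner_smul,
      LinearMap.adjoint_inner_left, LinearMap.restrictScalars_apply, LinearMap.restrictScalars_apply,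
      map_smul]

theorem adjointIntertwiner_inner (f : V →ₗ[R] W) (w : W) (v : V) :
    inner ℂ (adjointIntertwiner f w) v = inner ℂ w (f v) :=
  LinearMap.adjoint_inner_left (f.restrictScalars ℂ) v w

theorem exists_eq_smul_of_isSimpleModule {R V : Type*} [Ring R] [Algebra ℂ R] [AddCommGroup V]
    [Module ℂ V] [FiniteDimensional ℂ V] [Module R V] [IsScalarTower ℂ R V] [IsSimpleModule R V]
    (f : V →ₗ[R] V) :
    ∃ z : ℂ, ∀ v, f v = z • v := by
  obtain ⟨z, hz⟩ := (IsSimpleModule.algebraMap_end_bijective_of_isAlgClosed (A := R) (V := V) ℂ).2 f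
  exact ⟨z, fun v => by rw [← hz]; rfl⟩

/-- By Schur's lemma `g* g` is a scalar, so `g` multiplies all norms by one constant `a > 0`, and
`a⁻¹ • g` is isometric. -/
theorem exists_isometric_intertwiner [IsSimpleModule R V] (g : V ≃ₗ[R] W) :
    ∃ u : V ≃ₗ[R] W, ∀ x, ‖u x‖ = ‖x‖ := by
  obtain ⟨z, hz⟩ := exists_eq_smul_of_isSimpleModule
    (adjointIntertwiner (g : V →ₗ[R] W) ∘ₗ (g : V →ₗ[R] W))
  have hz' : ∀ x, ((‖g x‖ ^ 2 : ℝ) : ℂ) = z * ((‖x‖ ^ 2 : ℝ) : ℂ) := by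
    intro x
    have h1 := adjointIntertwiner_inner (g : V →ₗ[R] W) (g x) x
    have h2 : adjointIntertwiner (g : V →ₗ[R] W) (g x) = z • x := hz x
    rw [h2, ← inner_conj_symm, inner_smul_right] at h1
    have h3 := congrArg (starRingEnd ℂ) h1
    rw [Complex.conj_conj] at h3
    rw [inner_self_eq_norm_sq_to_K] at h3
    have h4 : inner ℂ (g x) ((g : V →ₗ[R] W) x) = ((‖g x‖ ^ 2 : ℝ) : ℂ) := by
      rw [LinearEquiv.coe_coe, inner_self_eq_norm_sq_to_K]
      push_cast
      rfl
    rw [h4, Complex.conj_ofReal] at h3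
    rw [← h3]
    push_cast
    rfl
  have : Nontrivial V := IsSimpleModule.nontrivial R V
  obtain ⟨x₀, hx₀⟩ := exists_ne (0 : V)
  have hpos : 0 < ‖x₀‖ := norm_pos_iff.2 hx₀
  have hgpos : 0 < ‖g x₀‖ := norm_pos_iff.2 ((map_ne_zero_iff g g.injective).2 hx₀)
  set a : ℝ := ‖g x₀‖ / ‖x₀‖ with ha
  have hapos : 0 < a := div_pos hgpos hpos
  have hza : z = ((a ^ 2 : ℝ) : ℂ) := by
    have h := hz' x₀
    have hne : ((‖x₀‖ ^ 2 : ℝ) : ℂ) ≠ 0 := Complex.ofReal_ne_zero.2 (by positivity)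
    rw [ha, div_pow, Complex.ofReal_div, h, mul_div_cancel_right₀ _ hne]
  have hga : ∀ x, ‖g x‖ = a * ‖x‖ := by
    intro x
    have h := hz' x
    rw [hza, ← Complex.ofReal_mul, Complex.ofReal_inj, ← mul_pow] at h
    exact (pow_left_inj₀ (norm_nonneg _) (by positivity) two_ne_zero).1 h
  have hne : ((a⁻¹ : ℝ) : ℂ) ≠ 0 := Complex.ofReal_ne_zero.2 (inv_ne_zero hapos.ne')
  have hbij : Function.Bijective (((a⁻¹ : ℝ) : ℂ) • (g : V →ₗ[R] W)) := by
    constructor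
    · intro x y hxy
      exact g.injective (smul_right_injective W hne hxy)
    · intro y
      refine ⟨g.symm (((a⁻¹ : ℝ) : ℂ)⁻¹ • y), ?_⟩
      rw [LinearMap.smul_apply, LinearEquiv.coe_coe, LinearEquiv.apply_symm_apply,
        smul_inv_smul₀ hne]
  refine ⟨LinearEquiv.ofBijective _ hbij, fun x => ?_⟩
  rw [LinearEquiv.ofBijective_apply, LinearMap.smul_apply, LinearEquiv.coe_coe, norm_smul, hga,
    Complex.norm_real, Real.norm_of_nonneg (inv_nonneg.2 hapos.le), inv_mul_cancel_left₀ hapos.ne']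

/-- The orthogonal complement of a subrepresentation. -/
def orthogonalComplement (N : Submodule R E) : Submodule R E where
  carrier := {x | ∀ y ∈ N, inner ℂ y x = 0}
  zero_mem' y _ := inner_zero_right y
  add_mem' {a b} ha hb y hy := by rw [inner_add_right, ha y hy, hb y hy, add_zero]
  smul_mem' r x hx y hy := by
    have := StarRep.inner_smul (star r) y x
    rw [star_star] at this
    rw [← this]
    exact hx _ (N.smul_mem _ hy)

theorem sup_orthogonalComplement (N : Submodule R E) : N ⊔ orthogonalComplement N = ⊤ := by
  rw [eq_top_iff]
  intro x _
  obtain ⟨y, hy, z, hz, rfl⟩ := (N.restrictScalars ℂ).exists_add_mem_mem_orthogonal x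
  exact Submodule.add_mem_sup hy fun w hw => hz w hw

theorem inf_orthogonalComplement {R E : Type*} [Ring R] [StarRing R] [NormedAddCommGroup E]
    [InnerProductSpace ℂ E] [Module R E] [StarRep R E] (N : Submodule R E) :
    N ⊓ orthogonalComplement N = ⊥ := by
  rw [eq_bot_iff]
  rintro x ⟨hx, hx'⟩
  exact (Submodule.mem_bot R).2 (inner_self_eq_zero.1 (hx' x hx))

/-- Well-founded induction: a simple submodule `M` of `N` is split off, and `N ⊓ M⊥` is strictly
smaller because `M` is nonzero. The modular law reassembles `N`. -/
theorem exists_orthogonal_simple_decomposition (N : Submodule R E) :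
    ∃ T : Set (Submodule R E), T.Finite ∧ (∀ M ∈ T, IsSimpleModule R M) ∧
      (∀ M ∈ T, ∀ M' ∈ T, M ≠ M' → M' ≤ orthogonalComplement M) ∧ sSup T = N := by
  have : IsArtinian R E := isArtinian_of_tower ℂ inferInstance
  induction N using WellFoundedLT.induction with
  | _ N ih =>
  rcases eq_bot_or_exists_atom_le N with rfl | ⟨M, hM, hMN⟩
  · exact ⟨∅, by simp⟩
  · have hlt : N ⊓ orthogonalComplement M < N := by
      refine lt_of_le_of_ne inf_le_left fun h => hM.1 ?_
      rw [eq_bot_iff, ← inf_orthogonalComplement M]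
      exact le_inf le_rfl (hMN.trans (inf_eq_left.1 h))
    obtain ⟨T, hfin, hsimple, horth, hsup⟩ := ih _ hlt
    have hT : ∀ M' ∈ T, M' ≤ orthogonalComplement M := fun M' hM' =>
      (le_sSup hM').trans (hsup.le.trans inf_le_right)
    refine ⟨insert M T, hfin.insert M, ?_, ?_, ?_⟩
    · rintro M' (rfl | hM')
      · exact isSimpleModule_iff_isAtom.2 hM
      · exact hsimple M' hM'
    · rintro M₁ (rfl | h₁) M₂ (rfl | h₂) hne
      · exact absurd rfl hne
      · exact hT M₂ h₂
      · intro x hx y hy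
        rw [← inner_conj_symm, hT M₁ h₁ hy x hx, map_zero]
      · exact horth M₁ h₁ M₂ h₂ hne
    · rw [sSup_insert, hsup, inf_comm, ← sup_inf_assoc_of_le _ hMN, sup_orthogonalComplement,
        top_inf_eq]

theorem isSemisimpleModule_of_starRep : IsSemisimpleModule R E := by
  rw [isSemisimpleModule_iff]
  exact ⟨fun N => ⟨orthogonalComplement N, disjoint_iff.2 (inf_orthogonalComplement N),
    codisjoint_iff.2 (sup_orthogonalComplement N)⟩⟩

instance (N : Submodule R E) : StarRep R (N.restrictScalars ℂ) where
  inner_smul r x y := StarRep.inner_smul r (x : E) (y : E)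

end StarRep

/-! ### Isotypic decomposition and density -/

section Decomposition

open scoped Matrix

theorem intertwiner_comp_comm {R V : Type*} [Ring R] [Algebra ℂ R] [AddCommGroup V] [Module ℂ V]
    [FiniteDimensional ℂ V] [Module R V] [IsScalarTower ℂ R V] [IsSimpleModule R V]
    (f : V →ₗ[R] V) (y : V →ₗ[ℂ] V) (v : V) : f (y v) = y (f v) := by
  obtain ⟨z, hz⟩ := exists_eq_smul_of_isSimpleModule f
  rw [hz, hz, map_smul]

theorem exists_isotypic_decomposition (R E : Type) [Ring R] [StarRing R] [Algebra ℂ R]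
    [NormedAddCommGroup E] [InnerProductSpace ℂ E] [FiniteDimensional ℂ E] [Module R E]
    [IsScalarTower ℂ R E] [StarRep R E] :
    ∃ (S Q : Type) (_ : Fintype S) (_ : DecidableEq S) (_ : Fintype Q) (_ : DecidableEq Q)
      (c : S → Q) (V : Q → Submodule R E)
      (J : ∀ w, (V (c w)).restrictScalars ℂ →ₗ[R] E),
      Function.Surjective c ∧ (∀ q, IsSimpleModule R ((V q).restrictScalars ℂ)) ∧
      (∀ q q', Nonempty ((V q).restrictScalars ℂ ≃ₗ[R] (V q').restrictScalars ℂ) → q = q') ∧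
      ∀ (n : Q → ℕ) (v : ∀ q, OrthonormalBasis (Fin (n q)) ℂ ((V q).restrictScalars ℂ)),
        ∃ b : OrthonormalBasis (Σ w, Fin (n (c w))) ℂ E, ∀ w t, b ⟨w, t⟩ = J w (v (c w) t) := by
  classical
  obtain ⟨T, hfin, hsimple, horth, hsup⟩ :=
    exists_orthogonal_simple_decomposition (⊤ : Submodule R E)
  have : Fintype T := hfin.fintype
  let H : T → Submodule ℂ E := fun w => w.1.restrictScalars ℂ
  have hH : ∀ w : T, IsSimpleModule R (w.1.restrictScalars ℂ) := fun w => hsimple w.1 w.2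
  have hfam : OrthogonalFamily ℂ (fun w => H w) fun w => (H w).subtypeₗᵢ := by
    intro w w' hne x y
    exact horth w.1 w.2 w'.1 w'.2 (fun h => hne (Subtype.ext h)) y.2 x x.2
  have hint : DirectSum.IsInternal H := by
    rw [hfam.isInternal_iff, Submodule.orthogonal_eq_bot_iff, ← Submodule.restrictScalars_iSup,
      ← sSup_eq_iSup', hsup]
    rfl
  let iso : Setoid T :=
    { r := fun w w' => Nonempty (w.1.restrictScalars ℂ ≃ₗ[R] w'.1.restrictScalars ℂ)
      iseqv := ⟨fun w => ⟨LinearEquiv.refl R _⟩, fun ⟨f⟩ => ⟨f.symm⟩, fun ⟨f⟩ ⟨g⟩ => ⟨f.trans g⟩⟩ }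
  let c : T → Quotient iso := Quotient.mk iso
  -- One summand represents each isomorphism class; isometries carry its orthonormal basis to the
  -- other summands of the class.
  let V : Quotient iso → Submodule R E := fun q => q.out.1
  have hV : ∀ q, IsSimpleModule R ((V q).restrictScalars ℂ) := fun q => hH q.out
  have hu : ∀ w : T, ∃ u : (V (c w)).restrictScalars ℂ ≃ₗ[R] w.1.restrictScalars ℂ,
      ∀ x, ‖u x‖ = ‖x‖ := by
    intro w
    obtain ⟨g⟩ : Nonempty ((V (c w)).restrictScalars ℂ ≃ₗ[R] w.1.restrictScalars ℂ) :=
      Quotient.exact (Quotient.out_eq (c w))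
    exact exists_isometric_intertwiner g
  choose u hu using hu
  let U : ∀ w : T, (V (c w)).restrictScalars ℂ ≃ₗᵢ[ℂ] H w := fun w =>
    { (u w).restrictScalars ℂ with norm_map' := hu w }
  let ι : ∀ w : T, w.1.restrictScalars ℂ →ₗ[R] E := fun w => w.1.subtype
  refine ⟨T, Quotient iso, inferInstance, inferInstance, inferInstance, inferInstance, c, V,
    fun w => ι w ∘ₗ (u w : (V (c w)).restrictScalars ℂ →ₗ[R] w.1.restrictScalars ℂ),
    Quotient.mk_surjective, hV, ?_, ?_⟩
  · intro q q' h
    rw [← Quotient.out_eq q, ← Quotient.out_eq q']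
    exact Quotient.sound h
  · intro n v
    refine ⟨hint.collectedOrthonormalBasis hfam fun w => (v (c w)).map (U w), fun w t => ?_⟩
    simp only [DirectSum.IsInternal.collectedOrthonormalBasis, Module.Basis.coe_toOrthonormalBasis,
      DirectSum.IsInternal.collectedBasis_coe]
    rfl

/-- A double commutant argument. The operator `Y` acting as `y q` on every copy of `V q` commutes
with all `R`-endomorphisms of `E`, since intertwiners between the simple modules are zero or scalar.
Density then yields an `r` that agrees with `Y` on the finite basis `b`. -/
theorem exists_smul_eq_of_isotypic {R E S Q : Type} [Ring R] [StarRing R] [Algebra ℂ R]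
    [NormedAddCommGroup E] [InnerProductSpace ℂ E] [FiniteDimensional ℂ E] [Module R E]
    [IsScalarTower ℂ R E] [StarRep R E] [Fintype S] [DecidableEq S] {c : S → Q} {V : Q → Type}
    [∀ q, NormedAddCommGroup (V q)] [∀ q, InnerProductSpace ℂ (V q)]
    [∀ q, FiniteDimensional ℂ (V q)] [∀ q, Module R (V q)] [∀ q, IsScalarTower ℂ R (V q)]
    [∀ q, StarRep R (V q)] [∀ q, IsSimpleModule R (V q)]
    (hV : ∀ q q', Nonempty (V q ≃ₗ[R] V q') → q = q') (J : ∀ w, V (c w) →ₗ[R] E) {n : Q → ℕ}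
    (v : ∀ q, OrthonormalBasis (Fin (n q)) ℂ (V q))
    (b : OrthonormalBasis (Σ w, Fin (n (c w))) ℂ E) (hb : ∀ w t, b ⟨w, t⟩ = J w (v (c w) t))
    (y : ∀ q, V q →ₗ[ℂ] V q) :
    ∃ r : R, ∀ w t, r • b ⟨w, t⟩ = J w (y (c w) (v (c w) t)) := by
  classical
  have hcomm : ∀ q q' (f : V q →ₗ[R] V q') x, f (y q x) = y q' (f x) := by
    intro q q' f x
    rcases LinearMap.bijective_or_eq_zero f with hf | hf
    · obtain rfl := hV q q' ⟨LinearEquiv.ofBijective f hf⟩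
      exact intertwiner_comp_comm f (y q) x
    · rw [hf, LinearMap.zero_apply, LinearMap.zero_apply, map_zero]
  -- The operators `J w (J w)*` form a resolution of the identity, because the images under `J w` of
  -- the bases `v` make up the orthonormal basis `b`.
  have hsum : ∀ x : E, ∑ w, J w (adjointIntertwiner (J w) x) = x := by
    intro x
    refine Eq.trans ?_ (b.sum_repr' x)
    rw [Fintype.sum_sigma]
    refine Finset.sum_congr rfl fun w _ => ?_
    rw [← (v (c w)).sum_repr' (adjointIntertwiner (J w) x), map_sum]
    refine Finset.sum_congr rfl fun t _ => ?_
    rw [← inner_conj_symm, adjointIntertwiner_inner, inner_conj_symm, hb]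
    exact ((J w).restrictScalars ℂ).map_smul _ _
  let Y : E →ₗ[ℂ] E := b.toBasis.constr ℂ fun i => J i.1 (y (c i.1) (v (c i.1) i.2))
  have hYb : ∀ w t, Y (b ⟨w, t⟩) = J w (y (c w) (v (c w) t)) := by
    intro w t
    have := b.toBasis.constr_basis ℂ (fun i => J i.1 (y (c i.1) (v (c i.1) i.2))) ⟨w, t⟩
    rwa [OrthonormalBasis.coe_toBasis] at this
  have hYJ : ∀ w x, Y (J w x) = J w (y (c w) x) := by
    intro w x
    have : Y ∘ₗ (J w).restrictScalars ℂ = (J w).restrictScalars ℂ ∘ₗ y (c w) := by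
      refine (v (c w)).toBasis.ext fun t => ?_
      rw [OrthonormalBasis.coe_toBasis, LinearMap.comp_apply, LinearMap.comp_apply,
        LinearMap.restrictScalars_apply, LinearMap.restrictScalars_apply, ← hb, hYb]
    exact LinearMap.congr_fun this x
  have hTY : ∀ (f : Module.End R E) x, Y (f x) = f (Y x) := by
    intro f x
    have hw : ∀ w z, Y (f (J w z)) = f (Y (J w z)) := by
      intro w z
      rw [hYJ, ← hsum (f (J w z)), ← hsum (f (J w (y (c w) z))), map_sum]
      refine Finset.sum_congr rfl fun w' _ => ?_
      rw [hYJ]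
      congr 1
      exact (hcomm (c w) (c w') (adjointIntertwiner (J w') ∘ₗ f ∘ₗ J w) z).symm
    rw [← hsum x, map_sum, map_sum, map_sum, map_sum]
    exact Finset.sum_congr rfl fun w _ => hw w _
  let F : Module.End (Module.End R E) E :=
    { toFun := Y
      map_add' := map_add Y
      map_smul' := hTY }
  have : IsSemisimpleModule R E := isSemisimpleModule_of_starRep
  obtain ⟨r, hr⟩ := jacobson_density F (Finset.univ.image b)
  refine ⟨r, fun w t => ?_⟩
  rw [← hr _ (Finset.mem_image_of_mem _ (Finset.mem_univ _))]
  exact hYb w t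

theorem exists_adapted_orthonormalBasis (R E : Type) [Ring R] [StarRing R] [Algebra ℂ R]
    [NormedAddCommGroup E] [InnerProductSpace ℂ E] [FiniteDimensional ℂ E] [Module R E]
    [IsScalarTower ℂ R E] [StarRep R E] :
    ∃ (S Q : Type) (_ : Fintype S) (_ : DecidableEq S) (_ : Fintype Q) (_ : DecidableEq Q)
      (c : S → Q) (n : Q → ℕ) (b : OrthonormalBasis (Σ w, Fin (n (c w))) ℂ E),
      Function.Surjective c ∧ (∀ q, 0 < n q) ∧
      (∀ r : R, ∃ x : ∀ q, Matrix (Fin (n q)) (Fin (n q)) ℂ,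
        ∀ w t, r • b ⟨w, t⟩ = ∑ s, x (c w) s t • b ⟨w, s⟩) ∧
      ∀ x : ∀ q, Matrix (Fin (n q)) (Fin (n q)) ℂ, ∃ r : R,
        ∀ w t, r • b ⟨w, t⟩ = ∑ s, x (c w) s t • b ⟨w, s⟩ := by
  obtain ⟨S, Q, _, _, _, _, c, V, J, hc, hsimple, hV, hb⟩ := exists_isotypic_decomposition R E
  let n : Q → ℕ := fun q => Module.finrank ℂ ((V q).restrictScalars ℂ)
  let v : ∀ q, OrthonormalBasis (Fin (n q)) ℂ ((V q).restrictScalars ℂ) :=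
    fun q => stdOrthonormalBasis ℂ _
  obtain ⟨b, hb⟩ := hb n v
  have hJ : ∀ w (a : Fin (n (c w)) → ℂ),
      J w (∑ s, a s • v (c w) s) = ∑ s, a s • b ⟨w, s⟩ := by
    intro w a
    rw [map_sum]
    refine Finset.sum_congr rfl fun s _ => ?_
    rw [hb]
    exact ((J w).restrictScalars ℂ).map_smul _ _
  refine ⟨S, Q, inferInstance, inferInstance, inferInstance, inferInstance, c, n, b, hc, fun q => ?_,
    fun r => ⟨fun q s t => inner ℂ (v q s) (r • v q t), fun w t => ?_⟩, fun x => ?_⟩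
  · have := IsSimpleModule.nontrivial R ((V q).restrictScalars ℂ)
    exact Module.finrank_pos
  · rw [hb, ← map_smul, ← hJ, (v (c w)).sum_repr']
  · obtain ⟨r, hr⟩ := exists_smul_eq_of_isotypic hV J v b hb
      fun q => Matrix.toLin (v q).toBasis (v q).toBasis (x q)
    refine ⟨r, fun w t => ?_⟩
    rw [hr, ← hJ]
    congr 1
    have := Matrix.toLin_self (v (c w)).toBasis (v (c w)).toBasis (x (c w)) t
    simpa only [OrthonormalBasis.coe_toBasis] using this

end Decomposition

/-! ### Patterns classify unital star-subalgebras up to unitary similarity -/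

section StarSubalgebra

open scoped Matrix

theorem exists_orthonormalBasis_of_starAlgHom {R E : Type} [Ring R] [StarRing R] [Algebra ℂ R]
    [NormedAddCommGroup E] [InnerProductSpace ℂ E] [FiniteDimensional ℂ E] [CompleteSpace E]
    (φ : R →⋆ₐ[ℂ] E →L[ℂ] E) :
    ∃ (S Q : Type) (_ : Fintype S) (_ : DecidableEq S) (_ : Fintype Q) (_ : DecidableEq Q)
      (c : S → Q) (n : Q → ℕ) (b : OrthonormalBasis (Σ w, Fin (n (c w))) ℂ E),
      Function.Surjective c ∧ (∀ q, 0 < n q) ∧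
      (∀ r : R, ∃ x : ∀ q, Matrix (Fin (n q)) (Fin (n q)) ℂ,
        ∀ w t, φ r (b ⟨w, t⟩) = ∑ s, x (c w) s t • b ⟨w, s⟩) ∧
      ∀ x : ∀ q, Matrix (Fin (n q)) (Fin (n q)) ℂ, ∃ r : R,
        ∀ w t, φ r (b ⟨w, t⟩) = ∑ s, x (c w) s t • b ⟨w, s⟩ := by
  let _ : Module R E := Module.compHom E (φ : R →+* E →L[ℂ] E)
  have hsmul : ∀ (r : R) (x : E), r • x = φ r x := fun _ _ => rfl
  have : IsScalarTower ℂ R E := ⟨fun z r x => by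
    rw [hsmul, hsmul, map_smul, smul_apply]⟩
  have : StarRep R E := ⟨fun r x y => by
    rw [hsmul, hsmul, map_star, ContinuousLinearMap.star_eq_adjoint,
      ContinuousLinearMap.adjoint_inner_right]⟩
  exact exists_adapted_orthonormalBasis R E

theorem exists_hasBlockForm_of_starSubalgebra {k : ℕ}
    (A : StarSubalgebra ℂ (Matrix (Fin k) (Fin k) ℂ)) :
    ∃ (S Q : Type) (_ : Fintype S) (_ : DecidableEq S) (_ : Fintype Q) (_ : DecidableEq Q)
      (c : S → Q) (n : Q → ℕ), Function.Surjective c ∧ (∀ q, 0 < n q) ∧ HasBlockForm A c n := by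
  let Φ := Matrix.toEuclideanCLM (n := Fin k) (𝕜 := ℂ)
  obtain ⟨S, Q, _, _, _, _, c, n, b, hc, hn, h1, h2⟩ :=
    exists_orthonormalBasis_of_starAlgHom (E := EuclideanSpace ℂ (Fin k))
      (StarAlgHom.comp (StarAlgHomClass.toStarAlgHom Φ) A.subtype)
  let e := EuclideanSpace.basisFun (Fin k) ℂ
  let V : Matrix (Fin k) (Σ w, Fin (n (c w))) ℂ := e.toBasis.toMatrix b
  have hV1 : V * Vᴴ = 1 := e.toMatrix_orthonormalBasis_self_mul_conjTranspose b
  have hV2 : Vᴴ * V = 1 := e.toMatrix_orthonormalBasis_conjTranspose_mul_self b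
  have hVapp : ∀ i j, V i j = b j i := fun i j => rfl
  -- Since `V` is unitary, the matrix identity is equivalent to `X * V = V * blockHom c n x`, which
  -- is read column by column.
  have key : ∀ (X : Matrix (Fin k) (Fin k) ℂ) (x : ∀ q, Matrix (Fin (n q)) (Fin (n q)) ℂ),
      X = V * blockHom c n x * Vᴴ ↔
        ∀ w t, Φ X (b ⟨w, t⟩) = ∑ s, x (c w) s t • b ⟨w, s⟩ := by
    intro X x
    have hX : X = V * blockHom c n x * Vᴴ ↔ X * V = V * blockHom c n x := by
      constructor
      · intro h
        rw [h, Matrix.mul_assoc, hV2, Matrix.mul_one]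
      · intro h
        rw [← h, Matrix.mul_assoc, hV1, Matrix.mul_one]
    have hl : ∀ i w t, (X * V) i ⟨w, t⟩ = Φ X (b ⟨w, t⟩) i := by
      intro i w t
      rfl
    have hr : ∀ i w t, (V * blockHom c n x) i ⟨w, t⟩ =
        (∑ s, x (c w) s t • b ⟨w, s⟩ : EuclideanSpace ℂ (Fin k)) i := by
      intro i w t
      rw [Matrix.mul_apply, Fintype.sum_sigma, Finset.sum_eq_single w]
      · simp only [blockHom_apply, Matrix.blockDiagonal'_apply_eq, hVapp, WithLp.ofLp_sum,
          Finset.sum_apply, PiLp.smul_apply, smul_eq_mul, mul_comm]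
      · intro w' _ hne
        refine Finset.sum_eq_zero fun s _ => ?_
        rw [blockHom_apply, Matrix.blockDiagonal'_apply_ne _ _ _ hne, mul_zero]
      · exact fun h => absurd (Finset.mem_univ _) h
    rw [hX]
    constructor
    · intro h w t
      ext i
      rw [← hl, ← hr, h]
    · intro h
      ext i ⟨w, t⟩
      rw [hl, hr, h]
  refine ⟨S, Q, inferInstance, inferInstance, inferInstance, inferInstance, c, n, hc, hn,
    V, hV1, hV2, fun X => ⟨fun hX => ?_, ?_⟩⟩
  · obtain ⟨x, hx⟩ := h1 ⟨X, hX⟩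
    exact ⟨x, (key X x).2 hx⟩
  · rintro ⟨x, hx⟩
    obtain ⟨r, hr⟩ := h2 x
    have : (r : Matrix (Fin k) (Fin k) ℂ) = V * blockHom c n x * Vᴴ := (key _ x).2 hr
    rw [hx, ← this]
    exact r.2

/-- `A` has the block pattern `P`. -/
def HasPattern {k : ℕ} (A : StarSubalgebra ℂ (Matrix (Fin k) (Fin k) ℂ))
    (P : Multiset (ℕ × ℕ)) : Prop :=
  ∃ (S Q : Type) (_ : Fintype S) (_ : DecidableEq S) (_ : Fintype Q) (_ : DecidableEq Q)
    (c : S → Q) (n : Q → ℕ), Function.Surjective c ∧ (∀ q, 0 < n q) ∧ HasBlockForm A c n ∧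
      blockPattern c n = P

theorem exists_hasPattern {k : ℕ} (A : StarSubalgebra ℂ (Matrix (Fin k) (Fin k) ℂ)) :
    ∃ P, HasPattern A P := by
  obtain ⟨S, Q, _, _, _, _, c, n, hc, hn, h⟩ := exists_hasBlockForm_of_starSubalgebra A
  exact ⟨blockPattern c n, S, Q, _, _, _, _, c, n, hc, hn, h, rfl⟩

theorem HasPattern.mem {k : ℕ} {A : StarSubalgebra ℂ (Matrix (Fin k) (Fin k) ℂ)}
    {P : Multiset (ℕ × ℕ)} (h : HasPattern A P) : P ∈ pairPartitions k := by
  obtain ⟨S, Q, _, _, _, _, c, n, hc, hn, h, rfl⟩ := h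
  exact h.blockPattern_mem hc hn

theorem HasPattern.unique {k : ℕ} {A : StarSubalgebra ℂ (Matrix (Fin k) (Fin k) ℂ)}
    {P P' : Multiset (ℕ × ℕ)} (h : HasPattern A P) (h' : HasPattern A P') : P = P' := by
  obtain ⟨S, Q, _, _, _, _, c, n, hc, hn, h, rfl⟩ := h
  obtain ⟨S', Q', _, _, _, _, c', n', hc', hn', h', rfl⟩ := h'
  exact h.blockPattern_eq hc hn h' hc' hn'

theorem HasPattern.of_unitarySimilarity {k : ℕ}
    {A B : StarSubalgebra ℂ (Matrix (Fin k) (Fin k) ℂ)} {P : Multiset (ℕ × ℕ)}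
    (hAB : unitarySimilarity k A B) (h : HasPattern A P) : HasPattern B P := by
  obtain ⟨S, Q, _, _, _, _, c, n, hc, hn, h, rfl⟩ := h
  exact ⟨S, Q, _, _, _, _, c, n, hc, hn, h.of_unitarySimilarity hAB, rfl⟩

theorem HasPattern.unitarySimilarity {k : ℕ}
    {A B : StarSubalgebra ℂ (Matrix (Fin k) (Fin k) ℂ)} {P : Multiset (ℕ × ℕ)}
    (hA : HasPattern A P) (hB : HasPattern B P) : unitarySimilarity k A B := by
  obtain ⟨S, Q, _, _, _, _, c, n, hc, hn, hA, rfl⟩ := hA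
  obtain ⟨S', Q', _, _, _, _, c', n', hc', hn', hB, hP⟩ := hB
  exact hA.unitarySimilarity (hB.of_blockPattern_eq hP)

theorem exists_hasPattern_of_mem {k : ℕ} {P : Multiset (ℕ × ℕ)} (hP : P ∈ pairPartitions k) :
    ∃ A : StarSubalgebra ℂ (Matrix (Fin k) (Fin k) ℂ), HasPattern A P := by
  classical
  -- `P.ToType` distinguishes equal members of `P`, so a repeated pair yields separate factors; the
  -- factor of `q` receives `q.1.2` blocks of size `q.1.1`.
  let c : (Σ q : P.ToType, Fin q.1.2) → P.ToType := Sigma.fst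
  let n : P.ToType → ℕ := fun q => q.1.1
  have hpos : ∀ q : P.ToType, 1 ≤ q.1.1 ∧ 1 ≤ q.1.2 := fun q => hP.1 _ (Multiset.coe_mem)
  have hc : Function.Surjective c := fun q => ⟨⟨q, ⟨0, (hpos q).2⟩⟩, rfl⟩
  have hfib : ∀ q, Fintype.card {w // c w = q} = q.1.2 := by
    intro q
    rw [Fintype.card_congr (Equiv.sigmaSubtype q), Fintype.card_fin]
  have hpat : blockPattern c n = P := by
    rw [blockPattern]
    simp only [hfib]
    exact Multiset.map_univ_coe P
  have hk : ∑ w, n (c w) = k := by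
    rw [← sum_blockPattern, hpat, hP.2]
  obtain ⟨A, hA⟩ := exists_hasBlockForm c n hk
  exact ⟨A, _, _, _, _, _, _, c, n, hc, fun q => (hpos q).1, hA, hpat⟩

theorem card_quotient_unitarySimilarity (k : ℕ) :
    ENat.card (Quotient (unitarySimilarity k)) = (pairPartitions k).encard := by
  choose p hp using fun A : StarSubalgebra ℂ (Matrix (Fin k) (Fin k) ℂ) => exists_hasPattern A
  let F : Quotient (unitarySimilarity k) → Multiset (ℕ × ℕ) := Quotient.lift p fun A B hAB =>
    ((hp A).of_unitarySimilarity hAB).unique (hp B)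
  have hF : Function.Injective F := by
    intro a b
    induction a using Quotient.inductionOn with | _ A
    induction b using Quotient.inductionOn with | _ B
    intro h
    have hA : HasPattern A (p B) := by
      rw [show p B = p A from h.symm]
      exact hp A
    exact Quotient.sound (hA.unitarySimilarity (hp B))
  rw [← Set.encard_univ, ← hF.encard_image]
  congr 1
  ext P
  constructor
  · rintro ⟨a, -, rfl⟩
    induction a using Quotient.inductionOn with | _ A
    exact (hp A).mem
  · intro hP
    obtain ⟨A, hA⟩ := exists_hasPattern_of_mem hP
    exact ⟨Quotient.mk _ A, Set.mem_univ _, (hp A).unique hA⟩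

end StarSubalgebra

end SimpleMonge

theorem proposition3p8 (k : ℕ) :
    (SimpleMonge.G11Infty k).Finite ∧
    (SimpleMonge.G11Infty k).encard = (SimpleMonge.divisorPartitions k).encard ∧
    (SimpleMonge.G11Infty k).encard = (SimpleMonge.factorizationPatterns k).encard ∧
    (SimpleMonge.G11Infty k).encard = (SimpleMonge.unlabeledPartitions k).encard ∧
    (SimpleMonge.G11Infty k).encard =
      ENat.card (Quotient (SimpleMonge.unitarySimilarity k)) := by
  rw [SimpleMonge.encard_G11Infty, SimpleMonge.encard_divisorPartitions,
    SimpleMonge.factorizationPatterns_eq, SimpleMonge.encard_unlabeledPartitions,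
    SimpleMonge.card_quotient_unitarySimilarity]
  refine ⟨?_, rfl, rfl, rfl, rfl⟩
  rw [← Set.encard_ne_top_iff, SimpleMonge.encard_G11Infty, Set.encard_ne_top_iff]
  exact SimpleMonge.finite_pairPartitions k
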